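/- **Lemma 2.3.** Let $\Omega\subset\mathbb R^3$ be a bounded open set. For $\varepsilon>0$ and $k\in\mathbb Z^3$ put $Y_\varepsilon^k=\varepsilon k+\varepsilon(-\tfrac12,\tfrac12)^3$ and $\mathbf Z_\varepsilon=\{k\in\mathbb Z^3: Y_\varepsilon^k\subset\Omega\}$. Let $0<r_\varepsilon<R_\varepsilon\le\varepsilon/2$ (if $r_\varepsilon\ll R_\varepsilon\ll\varepsilon$ as $\varepsilon\to0$, this holds for all small $\varepsilon$), and put $$T_\varepsilon=\bigcup_{k\in\mathbf Z_\varepsilon}B(\varepsilon k,r_\varepsilon),\qquad \mathcal C_\varepsilon=\bigcup_{k\in\mathbf Z_\varepsilon}\{x: r_\varepsilon<|x-\varepsilon k|<R_\varepsilon\},\qquad dm_\varepsilon=\frac{3}{4\pi}\Big(\frac{\varepsilon}{r_\varepsilon}\Big)^3 1_{T_\varepsilon}\,dx .$$ For $\theta\in H^1_0(\Omega)$ define $$\tilde\tau^\varepsilon=\sum_{k\in\mathbf Z_\varepsilon}\Big(\frac1{4\pi r_\varepsilon^2}\int_{\partial B(\varepsilon k,r_\varepsilon)}\theta\,d\sigma\Big)1_{Y_\varepsilon^k},\qquad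 \tilde\theta^\varepsilon=\sum_{k\in\mathbf Z_\varepsilon}\Big(\frac1{4\pi R_\varepsilon^2}\int_{\partial B(\varepsilon k,R_\varepsilon)}\theta\,d\sigma\Big)1_{Y_\varepsilon^k},$$ where the values of $\theta$ on spheres are understood in the sense of traces. There is a constant $C>0$, depending only on $\Omega$ (not on $\varepsilon$, $r_\varepsilon$, $R_\varepsilon$, $\theta$), such that for every $\theta\in H_0^1(\Omega)$: $$\int_{\bigcup_{k\in\mathbf Z_\varepsilon}Y^k_\varepsilon}|\theta-\tilde\theta^\varepsilon|^2dx\le C\frac{\varepsilon^3}{R_\varepsilon}\int_\Omega|\nabla\theta|^2dx;$$ moreover $$\int_\Omega|\theta-\tilde\theta^\varepsilon|^2dx\le C\frac{\varepsilon^3}{R_\varepsilon}\int_\Omega|\nabla\theta|^2dx$$ provided that the boundary of $\Omega$ is regular in the following sense (which every bounded open set with Lipschitz boundary satisfies): there are $c,\rho_0>0$ with $|B(z,\rho)\setminus\Omega|\ge c\rho^3$ for all $z\in\partial\Omega$ and $0<\rho\le\rho_0$; $$\int_{T_\varepsilon}|\theta-\tilde\tau^\varepsilon|^2dx\le C r_\varepsilon^2\int_{T_\varepsilon}|\nabla\theta|^2dx,\qquad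 \int_\Omega|\tilde\theta^\varepsilon-\tilde\tau^\varepsilon|^2dx\le C\frac{\varepsilon^3}{r_\varepsilon}\int_{\mathcal C_\varepsilon}|\nabla\theta|^2dx .$$ Moreover $$\int_\Omega|\tilde\theta^\varepsilon|^2dx=\int|\tilde\theta^\varepsilon|^2dm_\varepsilon,\qquad \int_\Omega|\tilde\tau^\varepsilon|^2dx=\int|\tilde\tau^\varepsilon|^2dm_\varepsilon .$$ -/

import Mathlib

open MeasureTheory Filter Topology
open scoped ENNReal ContDiff

namespace Suspension

noncomputable section

/-- Three-dimensional Euclidean space. -/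
abbrev E3 : Type := EuclideanSpace ℝ (Fin 3)

/-! ### The Sobolev space `H¹₀(Ω)` -/

/-- `φ ∈ C_c^∞(Ω)`. -/
def IsTest (Ω : Set E3) (φ : E3 → ℝ) : Prop :=
  ContDiff ℝ ∞ φ ∧ HasCompactSupport φ ∧ tsupport φ ⊆ Ω

/-- `G` is the weak gradient of `u` in `Ω`: `∫_Ω u ∇φ = - ∫_Ω φ G` for every test function `φ`. -/
def HasWeakGradient (Ω : Set E3) (u : E3 → ℝ) (G : E3 → E3) : Prop :=
  LocallyIntegrableOn u Ω ∧ LocallyIntegrableOn G Ω ∧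
    ∀ φ : E3 → ℝ, IsTest Ω φ →
      ∫ x in Ω, u x • gradient φ x = -∫ x in Ω, φ x • G x

/-- The test functions `φ n` converge to `u` in `H¹(Ω)`, where `u` is an element of `H¹(Ω)`. -/
def TestApprox (Ω : Set E3) (u : E3 → ℝ) (φ : ℕ → E3 → ℝ) : Prop :=
  (∀ n, IsTest Ω (φ n)) ∧ MemLp u 2 (volume.restrict Ω) ∧
    ∃ G : E3 → E3, HasWeakGradient Ω u G ∧ MemLp G 2 (volume.restrict Ω) ∧
      Tendsto (fun n => eLpNorm (u - φ n) 2 (volume.restrict Ω)) atTop (𝓝 0) ∧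
      Tendsto (fun n => eLpNorm (G - gradient (φ n)) 2 (volume.restrict Ω)) atTop (𝓝 0)

/-- `u ∈ H¹₀(Ω)`, the closure of `C_c^∞(Ω)` in `H¹(Ω)`. Only the values of `u` almost everywhere
in `Ω` matter. -/
def MemH10 (Ω : Set E3) (u : E3 → ℝ) : Prop :=
  ∃ φ : ℕ → E3 → ℝ, TestApprox Ω u φ

/-! ### Traces and averages on spheres -/

/-- The surface measure `dσ` on the sphere with center `c` and radius `ρ`: the image of the surface
measure of the unit sphere under `ξ ↦ c + ρ ξ`, times `ρ²`. Its total mass is `4πρ²`. -/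
def surfaceMeasure (c : E3) (ρ : ℝ) : Measure E3 :=
  ENNReal.ofReal (ρ ^ 2) •
    Measure.map (fun ξ : Metric.sphere (0 : E3) 1 => c + ρ • (ξ : E3))
      (volume : Measure E3).toSphere

/-- `w` is the trace of `u ∈ H¹₀(Ω)` on the sphere with center `c` and radius `ρ`: the trace map is
the continuous extension of the restriction `φ ↦ φ|_S` from `C_c^∞(Ω)` to `H¹₀(Ω)`, with values in
`L²(S, dσ)`. -/
def IsSphereTrace (Ω : Set E3) (u : E3 → ℝ) (c : E3) (ρ : ℝ) (w : E3 → ℝ) : Prop :=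
  MemLp w 2 (surfaceMeasure c ρ) ∧
    ∃ φ : ℕ → E3 → ℝ, TestApprox Ω u φ ∧
      Tendsto (fun n => eLpNorm (w - φ n) 2 (surfaceMeasure c ρ)) atTop (𝓝 0)

open Classical in
/-- The trace of `u` on the sphere with center `c` and radius `ρ` (zero if there is no trace). -/
def sphereTrace (Ω : Set E3) (u : E3 → ℝ) (c : E3) (ρ : ℝ) : E3 → ℝ :=
  if h : ∃ w, IsSphereTrace Ω u c ρ w then h.choose else 0

/-- The average `(4πρ²)⁻¹ ∫_S u dσ` of (the trace of) `u ∈ H¹₀(Ω)` on the sphere `S` with center `c`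
and radius `ρ`. -/
def sphereMean (Ω : Set E3) (u : E3 → ℝ) (c : E3) (ρ : ℝ) : ℝ :=
  (4 * Real.pi * ρ ^ 2)⁻¹ * ∫ x, sphereTrace Ω u c ρ x ∂(surfaceMeasure c ρ)

/-! ### The periodic geometry -/

/-- The point `εk`, for `k ∈ ℤ³`. -/
def center (ε : ℝ) (k : Fin 3 → ℤ) : E3 := WithLp.toLp 2 (fun i => ε * (k i : ℝ))

/-- The open cell `εk + ε(-1/2, 1/2)³`. -/
def cell (ε : ℝ) (k : Fin 3 → ℤ) : Set E3 :=
  {x | ∀ i, x i - center ε k i ∈ Set.Ioo (-(ε / 2)) (ε / 2)}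

/-- The indices of the cells that are contained in `Ω`. -/
def cellIndices (Ω : Set E3) (ε : ℝ) : Set (Fin 3 → ℤ) := {k | cell ε k ⊆ Ω}

/-- The union of the cells that are contained in `Ω`. -/
def cells (Ω : Set E3) (ε : ℝ) : Set E3 := ⋃ k ∈ cellIndices Ω ε, cell ε k

/-- The union of the balls `B(εk, r)` over the cells contained in `Ω`. -/
def suspensions (Ω : Set E3) (ε r : ℝ) : Set E3 :=
  ⋃ k ∈ cellIndices Ω ε, Metric.ball (center ε k) r

/-- The union of the shells `{r < |x - εk| < R}` over the cells contained in `Ω`. -/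
def shells (Ω : Set E3) (ε r R : ℝ) : Set E3 :=
  ⋃ k ∈ cellIndices Ω ε, {x | r < dist x (center ε k) ∧ dist x (center ε k) < R}

/-- The measure `(3 / 4π) (ε / r)³ 1_T dx`, where `T` is the union of the balls of radius `r`. -/
def suspensionMeasure (Ω : Set E3) (ε r : ℝ) : Measure E3 :=
  ENNReal.ofReal (3 / (4 * Real.pi) * (ε / r) ^ 3) • volume.restrict (suspensions Ω ε r)

/-- The function that is constant on each cell contained in `Ω`, equal there to the average of `u`
over the sphere of radius `ρ` concentric with the cell, and that is zero elsewhere. -/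
def cellMean (Ω : Set E3) (u : E3 → ℝ) (ε ρ : ℝ) (x : E3) : ℝ :=
  ∑' k : cellIndices Ω ε,
    (cell ε (k : Fin 3 → ℤ)).indicator (fun _ => sphereMean Ω u (center ε k) ρ) x

/-- The squared `L²(μ)` norm, as an extended nonnegative number. -/
def normSq {F : Type*} [NormedAddCommGroup F] (μ : Measure E3) (f : E3 → F) : ℝ≥0∞ :=
  ∫⁻ x, ‖f x‖ₑ ^ 2 ∂μ

/-- Exterior measure density at the boundary: small balls centered on `∂Ω` lie outside `Ω` in a
fixed proportion. Every bounded open set with Lipschitz boundary has this property. -/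
def ExteriorDensity (Ω : Set E3) : Prop :=
  ∃ c > (0 : ℝ), ∃ ρ₀ > (0 : ℝ), ∀ z ∈ frontier Ω, ∀ ρ : ℝ, 0 < ρ → ρ ≤ ρ₀ →
    ENNReal.ofReal (c * ρ ^ 3) ≤ volume (Metric.ball z ρ \ Ω)

end

end Suspension

open Suspension

/-! Everything reduces to estimates on balls for a compactly supported $C^1$ function φ. These
survive $L^2$ limits of φ and ∇φ, and are then summed over the lattice.

The factors 1/r and 1/R come from one dimension. Along a ray, Cauchy-Schwarz with 1 = s⁻¹ · s gives
|φ(c+bξ) − φ(c+aξ)|² ≤ a⁻¹ ∫_a^b s² |∇φ(c+sξ)|² ds, because ∫_a^∞ s⁻² ds = a⁻¹ whatever b is. Since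
s² is the polar Jacobian, integration over ξ bounds the difference of two concentric sphere averages
by the energy of the shell between them (`sphereAverage_sub_sq_le`); summed over cells of volume ε³,
this is the third estimate. With b beyond the support, the same bound is a trace inequality
(`lintegral_sphere_sq_le`).

On a ball of radius L, the Poincaré inequality with the mean over the bounding sphere costs L²;
moving the mean to a sphere of radius R ≤ L costs L³/R
(`lintegral_ball_sub_sphereAverage_sq_le_of_le`). The choice L = R = r gives the second estimate.
The choice L = 2ε gives the first on the cells inside Ω: θ is extended by zero, as these balls may
leave Ω, and they overlap at most 125 times.

A cell that meets Ω without lying in it contains a boundary point z. There the cell mean is zero,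
and the approximating test functions vanish on B(z, ε) \ Ω, which has volume at least cε³, so a
Poincaré inequality without mean applies (`volume_mul_lintegral_ball_sq_le`).

The averages of θ are defined through a chosen trace. The trace inequality makes them the limits of
the averages of any approximating sequence (`Suspension.TestApprox.tendsto_sphereAverage`). The
equalities of norms only compare the volumes of balls and cells. -/

/-! ### Cauchy-Schwarz inequalities. -/

lemma ENNReal.sq_lintegral_mul_le {α : Type*} [MeasurableSpace α] (μ : Measure α)
    {f g : α → ℝ≥0∞} (hf : AEMeasurable f μ) (hg : AEMeasurable g μ) :
    (∫⁻ x, f x * g x ∂μ) ^ 2 ≤ (∫⁻ x, f x ^ 2 ∂μ) * ∫⁻ x, g x ^ 2 ∂μ := by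
  have h := ENNReal.lintegral_mul_le_Lp_mul_Lq μ Real.HolderConjugate.two_two hf hg
  simp only [Pi.mul_apply] at h
  calc (∫⁻ x, f x * g x ∂μ) ^ 2 ≤ _ := pow_le_pow_left₀ (zero_le) h 2
    _ = _ := by
      rw [mul_pow, ← ENNReal.rpow_mul_natCast, ← ENNReal.rpow_mul_natCast]
      simp

lemma enorm_integral_sq_le {α : Type*} [MeasurableSpace α] (μ : Measure α)
    {f : α → ℝ} (hf : AEStronglyMeasurable f μ) :
    ‖∫ x, f x ∂μ‖ₑ ^ 2 ≤ μ Set.univ * ∫⁻ x, ‖f x‖ₑ ^ 2 ∂μ := by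
  have h := ENNReal.sq_lintegral_mul_le μ (f := fun _ => 1) (g := fun x => ‖f x‖ₑ)
    aemeasurable_const hf.enorm
  simp only [one_mul, one_pow, lintegral_const] at h
  exact (pow_le_pow_left₀ (zero_le) (enorm_integral_le_lintegral_enorm _) 2).trans h

lemma enorm_add_sq_le {F : Type*} [NormedAddCommGroup F] (a b : F) :
    ‖a + b‖ₑ ^ 2 ≤ 2 * ‖a‖ₑ ^ 2 + 2 * ‖b‖ₑ ^ 2 := by
  simp only [enorm_eq_nnnorm]
  norm_cast
  rw [← mul_add]
  exact (pow_le_pow_left₀ zero_le (nnnorm_add_le a b) 2).trans (add_sq_le)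

/-- Fundamental theorem of calculus with the Cauchy-Schwarz inequality. -/
lemma enorm_sub_sq_le_lintegral_deriv {f : ℝ → ℝ} (hf : ContDiff ℝ 1 f) {a b : ℝ} (hab : a ≤ b)
    {w v : ℝ → ℝ≥0∞} (hw : Measurable w) (hv : Measurable v)
    (hwv : ∀ s ∈ Set.Ioc a b, w s * v s = 1) :
    ‖f b - f a‖ₑ ^ 2 ≤ (∫⁻ s in Set.Ioc a b, w s ^ 2) *
      ∫⁻ s in Set.Ioc a b, v s ^ 2 * ‖deriv f s‖ₑ ^ 2 := by
  have hd : Continuous (deriv f) := hf.continuous_deriv le_rfl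
  have h1 : f b - f a = ∫ s in Set.Ioc a b, deriv f s := by
    rw [← intervalIntegral.integral_of_le hab, intervalIntegral.integral_deriv_eq_sub]
    · exact fun x _ => (hf.differentiable one_ne_zero) x
    · exact hd.intervalIntegrable _ _
  -- Insert 1 = w · v before Cauchy-Schwarz, so that the weight can be adapted to the geometry.
  have h2 : ∫⁻ s in Set.Ioc a b, ‖deriv f s‖ₑ
      = ∫⁻ s in Set.Ioc a b, w s * (v s * ‖deriv f s‖ₑ) := by
    refine setLIntegral_congr_fun measurableSet_Ioc fun s hs => ?_
    simp only [← mul_assoc, hwv s hs, one_mul]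
  have hm : Measurable fun s => v s * ‖deriv f s‖ₑ := hv.mul hd.measurable.enorm
  have h3 := ENNReal.sq_lintegral_mul_le (volume.restrict (Set.Ioc a b)) hw.aemeasurable
    hm.aemeasurable
  rw [← h2] at h3
  simp only [mul_pow] at h3
  rw [h1]
  exact (pow_le_pow_left₀ (zero_le) (enorm_integral_le_lintegral_enorm _) 2).trans h3

/-! ### Increments along segments and rays. -/

section Gradient

variable {E : Type*} [NormedAddCommGroup E] [InnerProductSpace ℝ E] [CompleteSpace E]

lemma ContDiff.continuous_gradient {φ : E → ℝ} (hφ : ContDiff ℝ 1 φ) :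
    Continuous (gradient φ) :=
  (InnerProductSpace.toDual ℝ E).symm.continuous.comp (hφ.continuous_fderiv one_ne_zero)

lemma gradient_sub {φ ψ : E → ℝ} (hφ : Differentiable ℝ φ) (hψ : Differentiable ℝ ψ) :
    gradient (φ - ψ) = gradient φ - gradient ψ := by
  ext1 x
  simp only [gradient, Pi.sub_apply, ← map_sub]
  rw [fderiv_sub (hφ x) (hψ x)]

lemma ContDiff.enorm_deriv_line_le {φ : E → ℝ} (hφ : ContDiff ℝ 1 φ) (p v : E) (s : ℝ) :
    ‖deriv (fun t : ℝ => φ (p + t • v)) s‖ₑ ≤ ‖gradient φ (p + s • v)‖ₑ * ‖v‖ₑ := by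
  have h1 : HasDerivAt (fun t : ℝ => p + t • v) v s := by
    simpa using ((hasDerivAt_id s).smul_const v).const_add p
  have h2 := ((hφ.differentiable one_ne_zero) (p + s • v)).hasFDerivAt.comp_hasDerivAt s h1
  have h3 : ‖gradient φ (p + s • v)‖ₑ = ‖fderiv ℝ φ (p + s • v)‖ₑ := by
    rw [← toDual_gradient, ← ofReal_norm, ← ofReal_norm, LinearIsometryEquiv.norm_map]
  rw [h3, show deriv (fun t : ℝ => φ (p + t • v)) s = _ from h2.deriv]
  exact ContinuousLinearMap.le_opENorm _ _

lemma ContDiff.enorm_sub_sq_le_segment {φ : E → ℝ} (hφ : ContDiff ℝ 1 φ) (x y : E) :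
    ‖φ x - φ y‖ₑ ^ 2 ≤
      ‖x - y‖ₑ ^ 2 * ∫⁻ t in Set.Ioc (0 : ℝ) 1, ‖gradient φ (y + t • (x - y))‖ₑ ^ 2 := by
  have hc : ContDiff ℝ 1 fun t : ℝ => φ (y + t • (x - y)) := hφ.comp (by fun_prop)
  have h := enorm_sub_sq_le_lintegral_deriv hc zero_le_one (w := fun _ => 1) (v := fun _ => 1)
    measurable_const measurable_const (by simp)
  simp only [one_smul, zero_smul, add_zero, add_sub_cancel, one_pow, lintegral_const,
    MeasurableSet.univ, Measure.restrict_apply, Set.univ_inter, Real.volume_Ioc, sub_zero,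
    ENNReal.ofReal_one, one_mul] at h
  refine h.trans ?_
  rw [← lintegral_const_mul' _ _ (by simp)]
  refine lintegral_mono fun t => ?_
  rw [mul_comm, ← mul_pow]
  exact pow_le_pow_left₀ (zero_le) (hφ.enorm_deriv_line_le _ _ _) 2

end Gradient

lemma lintegral_Ioi_inv_sq {a : ℝ} (ha : 0 < a) :
    ∫⁻ s in Set.Ioi a, ENNReal.ofReal s⁻¹ ^ 2 = ENNReal.ofReal a⁻¹ := by
  have h1 : ∀ s ∈ Set.Ioi a, ENNReal.ofReal s⁻¹ ^ 2 = ENNReal.ofReal (s ^ (-2 : ℝ)) := by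
    intro s hs
    have hs0 : 0 < s := ha.trans hs
    rw [← ENNReal.ofReal_pow (by positivity), Real.rpow_neg hs0.le]
    norm_num
  rw [setLIntegral_congr_fun measurableSet_Ioi h1, ← ofReal_integral_eq_lintegral_ofReal
    (integrableOn_Ioi_rpow_of_lt (by norm_num) ha)
    ((ae_restrict_iff' measurableSet_Ioi).2 (ae_of_all _ fun s hs =>
      Real.rpow_nonneg (ha.trans hs).le _)), integral_Ioi_rpow_of_lt (by norm_num) ha]
  norm_num [Real.rpow_neg_one]

/-- The weights are s⁻¹ and s. The first integrates to at most a⁻¹ uniformly in b, and the square of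
the second is the polar Jacobian. -/
lemma ContDiff.enorm_sub_sq_le_ray {φ : E3 → ℝ} (hφ : ContDiff ℝ 1 φ) (c : E3)
    (ξ : Metric.sphere (0 : E3) 1) {a b : ℝ} (ha : 0 < a) (hab : a ≤ b) :
    ‖φ (c + b • (ξ : E3)) - φ (c + a • (ξ : E3))‖ₑ ^ 2 ≤ ENNReal.ofReal a⁻¹ *
      ∫⁻ s in Set.Ioo a b, ENNReal.ofReal (s ^ 2) * ‖gradient φ (c + s • (ξ : E3))‖ₑ ^ 2 := by
  rw [Measure.restrict_congr_set Ioo_ae_eq_Ioc]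
  have hc : ContDiff ℝ 1 fun t : ℝ => φ (c + t • (ξ : E3)) := hφ.comp (by fun_prop)
  have h := enorm_sub_sq_le_lintegral_deriv hc hab (w := fun s => ENNReal.ofReal s⁻¹)
    (v := fun s => ENNReal.ofReal s) (by fun_prop) (by fun_prop) (by
      intro s hs
      have hs0 : 0 < s := ha.trans hs.1
      rw [← ENNReal.ofReal_mul (by positivity), inv_mul_cancel₀ hs0.ne', ENNReal.ofReal_one])
  refine h.trans (mul_le_mul' ?_ ?_)
  · rw [← lintegral_Ioi_inv_sq ha]
    exact lintegral_mono_set Set.Ioc_subset_Ioi_self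
  · refine setLIntegral_mono' measurableSet_Ioc fun s hs => ?_
    rw [ENNReal.ofReal_pow (ha.trans hs.1).le]
    gcongr
    refine (hφ.enorm_deriv_line_le c ξ s).trans_eq ?_
    rw [← ofReal_norm (ξ : E3), mem_sphere_zero_iff_norm.1 ξ.2]
    simp

/-! ### Polar coordinates. -/

/-- Integration in polar coordinates. -/
lemma lintegral_polar {F : E3 → ℝ≥0∞} (hF : Measurable F) (c : E3) :
    ∫⁻ x, F x = ∫⁻ ξ, (∫⁻ s in Set.Ioi (0 : ℝ), ENNReal.ofReal (s ^ 2) * F (c + s • (ξ : E3)))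
      ∂(volume : Measure E3).toSphere := by
  have hmp := (volume : Measure E3).measurePreserving_homeomorphUnitSphereProd
  have hF' : Measurable fun x => F (c + x) := hF.comp (by fun_prop)
  have hF'' : Measurable fun x : ({0}ᶜ : Set E3) => F (c + x) := hF'.comp measurable_subtype_coe
  have h1 := hmp.symm (homeomorphUnitSphereProd E3).toMeasurableEquiv
  have h2 := h1.lintegral_comp hF''
  have h3 := h1.measurable
  calc ∫⁻ x, F x = ∫⁻ x in ({0}ᶜ : Set E3), F (c + x) := by
        rw [← lintegral_add_left_eq_self F c, restrict_compl_singleton]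
    _ = ∫⁻ x : ({0}ᶜ : Set E3), F (c + x) ∂(Measure.comap Subtype.val volume) :=
        (lintegral_subtype_comap (measurableSet_singleton (0 : E3)).compl _).symm
    _ = _ := by
        rw [← h2]
        refine (lintegral_prod _ (hF''.comp h3).aemeasurable).trans ?_
        refine lintegral_congr fun ξ => ?_
        simp only [Function.comp_apply]
        have h4 : Measurable fun s : Set.Ioi (0 : ℝ) => F (c + (s : ℝ) • (ξ : E3)) :=
          hF.comp (by fun_prop)
        have h5 : ∀ s : Set.Ioi (0 : ℝ),
            ((homeomorphUnitSphereProd E3).toMeasurableEquiv.symm (ξ, s) : E3) = (s : ℝ) • (ξ : E3) :=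
          fun s => rfl
        simp only [h5]
        rw [Measure.volumeIoiPow, lintegral_withDensity_eq_lintegral_mul _ (by fun_prop) h4,
          ← lintegral_subtype_comap measurableSet_Ioi]
        simp

lemma setLIntegral_polar {F : E3 → ℝ≥0∞} (hF : Measurable F) (c : E3) {T : Set ℝ}
    (hT : MeasurableSet T) (hT0 : T ⊆ Set.Ioi 0) :
    ∫⁻ x in {x | dist x c ∈ T}, F x =
      ∫⁻ ξ, (∫⁻ s in T, ENNReal.ofReal (s ^ 2) * F (c + s • (ξ : E3)))
        ∂(volume : Measure E3).toSphere := by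
  have hm : MeasurableSet {x : E3 | dist x c ∈ T} := (by fun_prop : Measurable fun x => dist x c) hT
  rw [← lintegral_indicator hm, lintegral_polar (hF.indicator hm) c]
  refine lintegral_congr fun ξ => ?_
  refine Eq.trans ?_ ((setLIntegral_indicator (t := Set.Ioi 0) hT _).trans
    (by rw [Set.inter_eq_self_of_subset_left hT0]))
  refine setLIntegral_congr_fun measurableSet_Ioi fun s (hs : 0 < s) => ?_
  have hd : dist (c + s • (ξ : E3)) c = s := by
    rw [dist_eq_norm, add_sub_cancel_left, norm_smul, mem_sphere_zero_iff_norm.1 ξ.2]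
    simp [abs_of_pos hs]
  by_cases h : s ∈ T
  · have h' : c + s • (ξ : E3) ∈ {x | dist x c ∈ T} := by rwa [Set.mem_ofPred_eq, hd]
    simp only [Set.indicator_of_mem h', Set.indicator_of_mem h]
  · have h' : c + s • (ξ : E3) ∉ {x | dist x c ∈ T} := by rwa [Set.mem_ofPred_eq, hd]
    simp only [Set.indicator_of_notMem h', Set.indicator_of_notMem h, mul_zero]

lemma setLIntegral_ball_polar {F : E3 → ℝ≥0∞} (hF : Measurable F) (c : E3) (L : ℝ) :
    ∫⁻ x in Metric.ball c L, F x =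
      ∫⁻ ξ, (∫⁻ s in Set.Ioo 0 L, ENNReal.ofReal (s ^ 2) * F (c + s • (ξ : E3)))
        ∂(volume : Measure E3).toSphere := by
  rw [← setLIntegral_polar hF c measurableSet_Ioo Set.Ioo_subset_Ioi_self]
  have : {x : E3 | dist x c ∈ Set.Ioo 0 L} = Metric.ball c L \ {c} := by
    ext x
    simp [dist_pos, and_comm]
  rw [this]
  exact setLIntegral_congr (sdiff_null_ae_eq_self (measure_singleton c)).symm

lemma toSphere_univ : (volume : Measure E3).toSphere Set.univ = ENNReal.ofReal (4 * Real.pi) := by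
  rw [Measure.toSphere_apply_univ, EuclideanSpace.volume_ball_fin_three]
  simp only [finrank_euclideanSpace, Fintype.card_fin]
  rw [← ENNReal.ofReal_pow zero_le_one, ← ENNReal.ofReal_mul (by positivity),
    ← ENNReal.ofReal_natCast, ← ENNReal.ofReal_mul (by positivity)]
  congr 1
  push_cast
  ring

/-! ### Double integrals of differences over a ball. -/

/-- The homothety with center y and ratio t maps the ball into itself by convexity, and its inverse
has Jacobian t⁻³ ≤ 8. The lower bound on t is what keeps this factor bounded. -/
lemma lintegral_convex_comb_le {F : E3 → ℝ≥0∞} (hF : Measurable F) (c : E3) {L t : ℝ}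
    (ht : 1 / 2 ≤ t) (ht1 : t ≤ 1) {y : E3} (hy : y ∈ Metric.ball c L) :
    ∫⁻ x in Metric.ball c L, F (y + t • (x - y)) ≤ 8 * ∫⁻ x in Metric.ball c L, F x := by
  have ht0 : 0 < t := by linarith
  have hmap : Measure.map (fun x : E3 => y + t • (x - y)) volume
      = ENNReal.ofReal |(t ^ 3)⁻¹| • volume := by
    have h1 := Measure.map_addHaar_smul (volume : Measure E3) ht0.ne'
    rw [finrank_euclideanSpace, Fintype.card_fin] at h1
    have h2 : (fun x : E3 => y + t • (x - y)) = (fun z => (y - t • y) + z) ∘ (t • ·) := by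
      ext1 x
      simp only [Function.comp_apply, smul_sub]
      abel
    rw [h2, ← Measure.map_map (by fun_prop) (by fun_prop), h1, Measure.map_smul, map_add_left_eq_self]
  have hm : Measurable fun x : E3 => y + t • (x - y) := by fun_prop
  calc ∫⁻ x in Metric.ball c L, F (y + t • (x - y))
      ≤ ∫⁻ x, (Metric.ball c L).indicator F (y + t • (x - y)) := by
        rw [← lintegral_indicator measurableSet_ball]
        refine lintegral_mono fun x => ?_
        by_cases hx : x ∈ Metric.ball c L
        · have : y + t • (x - y) ∈ Metric.ball c L :=
            (convex_ball c L).add_smul_sub_mem hy hx ⟨ht0.le, ht1⟩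
          simp [hx, this]
        · simp [hx]
    _ = ENNReal.ofReal |(t ^ 3)⁻¹| * ∫⁻ x in Metric.ball c L, F x := by
        rw [← lintegral_map (hF.indicator measurableSet_ball) hm, hmap, lintegral_smul_measure,
          lintegral_indicator measurableSet_ball, smul_eq_mul]
    _ ≤ _ := by
        gcongr
        rw [show (8 : ℝ≥0∞) = ENNReal.ofReal 8 by simp]
        refine ENNReal.ofReal_le_ofReal ?_
        rw [abs_of_pos (by positivity), inv_le_comm₀ (by positivity) (by norm_num)]
        calc (8 : ℝ)⁻¹ = (1 / 2) ^ 3 := by norm_num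
          _ ≤ t ^ 3 := by gcongr

lemma lintegral_lintegral_convex_comb_le {F : E3 → ℝ≥0∞} (hF : Measurable F) (c : E3) {L t : ℝ}
    (ht0 : 0 ≤ t) (ht1 : t ≤ 1) :
    ∫⁻ x in Metric.ball c L, ∫⁻ y in Metric.ball c L, F (y + t • (x - y)) ≤
      8 * volume (Metric.ball c L) * ∫⁻ x in Metric.ball c L, F x := by
  have key : ∀ t : ℝ, 1 / 2 ≤ t → t ≤ 1 →
      ∫⁻ y in Metric.ball c L, ∫⁻ x in Metric.ball c L, F (y + t • (x - y)) ≤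
      8 * volume (Metric.ball c L) * ∫⁻ x in Metric.ball c L, F x := by
    intro t ht ht1
    refine (setLIntegral_mono' measurableSet_ball fun y hy =>
      lintegral_convex_comb_le hF c ht ht1 hy).trans_eq ?_
    rw [setLIntegral_const]
    ring
  rcases le_total (1 / 2) t with ht | ht
  · rw [lintegral_lintegral_swap]
    · exact key t ht ht1
    · exact (hF.comp (by fun_prop)).aemeasurable
  -- For small t exchange the roles of the two points: y + t(x − y) = x + (1 − t)(y − x).
  · refine le_trans (le_of_eq ?_) (key (1 - t) (by linarith) (by linarith))
    congr! 4 with x y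
    simp only [sub_smul, one_smul, smul_sub]
    abel_nf

/-- Integrate the gradient along the segment from y to x, then integrate over x and y for each fixed
t. The constant is 32 = 4 · 8: the squared diameter 4L² times the Jacobian bound 8. -/
lemma ContDiff.lintegral_lintegral_sub_sq_le {φ : E3 → ℝ} (hφ : ContDiff ℝ 1 φ) (c : E3) {L : ℝ}
    (hL : 0 < L) :
    ∫⁻ x in Metric.ball c L, ∫⁻ y in Metric.ball c L, ‖φ x - φ y‖ₑ ^ 2 ≤
      volume (Metric.ball c L) * (ENNReal.ofReal (32 * L ^ 2) *
        ∫⁻ x in Metric.ball c L, ‖gradient φ x‖ₑ ^ 2) := by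
  set D := Metric.ball c L
  have hG : Continuous (gradient φ) := hφ.continuous_gradient
  have hF : Measurable fun x => ‖gradient φ x‖ₑ ^ 2 := hG.measurable.enorm.pow_const 2
  have hxy : ∀ x ∈ D, ∀ y ∈ D, ‖φ x - φ y‖ₑ ^ 2 ≤ ENNReal.ofReal (4 * L ^ 2) *
      ∫⁻ t in Set.Ioc (0 : ℝ) 1, ‖gradient φ (y + t • (x - y))‖ₑ ^ 2 := by
    intro x hx y hy
    refine (hφ.enorm_sub_sq_le_segment x y).trans ?_
    gcongr
    rw [← ofReal_norm, ← ENNReal.ofReal_pow (norm_nonneg _)]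
    refine ENNReal.ofReal_le_ofReal ?_
    have : ‖x - y‖ ≤ 2 * L := by
      rw [← dist_eq_norm]
      linarith [dist_triangle_right x y c, Metric.mem_ball.1 hx, Metric.mem_ball.1 hy]
    calc ‖x - y‖ ^ 2 ≤ (2 * L) ^ 2 := by gcongr
      _ = _ := by ring
  have hm3 : Measurable fun p : (E3 × E3) × ℝ =>
      ‖gradient φ (p.1.2 + p.2 • (p.1.1 - p.1.2))‖ₑ ^ 2 := hF.comp (by fun_prop)
  have hm3' : Measurable fun p : (E3 × ℝ) × E3 =>
      ‖gradient φ (p.2 + p.1.2 • (p.1.1 - p.2))‖ₑ ^ 2 := hF.comp (by fun_prop)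
  calc ∫⁻ x in D, ∫⁻ y in D, ‖φ x - φ y‖ₑ ^ 2
      ≤ ∫⁻ x in D, ∫⁻ y in D, ENNReal.ofReal (4 * L ^ 2) *
          ∫⁻ t in Set.Ioc (0 : ℝ) 1, ‖gradient φ (y + t • (x - y))‖ₑ ^ 2 :=
        setLIntegral_mono' measurableSet_ball fun x hx =>
          setLIntegral_mono' measurableSet_ball fun y hy => hxy x hx y hy
    _ = ENNReal.ofReal (4 * L ^ 2) * ∫⁻ x in D, ∫⁻ y in D,
          ∫⁻ t in Set.Ioc (0 : ℝ) 1, ‖gradient φ (y + t • (x - y))‖ₑ ^ 2 := by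
        rw [← lintegral_const_mul' _ _ ENNReal.ofReal_ne_top]
        refine lintegral_congr fun x => ?_
        rw [lintegral_const_mul' _ _ ENNReal.ofReal_ne_top]
    _ = ENNReal.ofReal (4 * L ^ 2) * ∫⁻ t in Set.Ioc (0 : ℝ) 1, ∫⁻ x in D, ∫⁻ y in D,
          ‖gradient φ (y + t • (x - y))‖ₑ ^ 2 := by
        congr 1
        calc _ = ∫⁻ x in D, ∫⁻ t in Set.Ioc (0 : ℝ) 1, ∫⁻ y in D,
                ‖gradient φ (y + t • (x - y))‖ₑ ^ 2 :=
              lintegral_congr fun x => lintegral_lintegral_swap (hF.comp (by fun_prop)).aemeasurable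
          _ = _ := lintegral_lintegral_swap (Measurable.lintegral_prod_right' hm3').aemeasurable
    _ ≤ ENNReal.ofReal (4 * L ^ 2) * ∫⁻ t in Set.Ioc (0 : ℝ) 1,
          8 * volume D * ∫⁻ x in D, ‖gradient φ x‖ₑ ^ 2 := by
        refine mul_le_mul_right ?_ _
        exact setLIntegral_mono' measurableSet_Ioc fun t ht =>
          lintegral_lintegral_convex_comb_le hF c ht.1.le ht.2
    _ = _ := by
        rw [setLIntegral_const, Real.volume_Ioc, show 32 * L ^ 2 = 4 * L ^ 2 * 8 by ring,
          ENNReal.ofReal_mul (p := 4 * L ^ 2) (by positivity)]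
        simp only [sub_zero, ENNReal.ofReal_one, mul_one, ENNReal.ofReal_ofNat]
        ring

/-! ### Averages over spheres. -/

/-- The average of `φ` over the sphere with center `c` and radius `ρ`, for continuous `φ`. -/
noncomputable def sphereAverage (φ : E3 → ℝ) (c : E3) (ρ : ℝ) : ℝ :=
  (4 * Real.pi)⁻¹ * ∫ ξ : Metric.sphere (0 : E3) 1, φ (c + ρ • (ξ : E3))
    ∂(volume : Measure E3).toSphere

lemma enorm_average_sq_le {f : Metric.sphere (0 : E3) 1 → ℝ} (hf : Continuous f) :
    ENNReal.ofReal (4 * Real.pi) *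
      ‖(4 * Real.pi)⁻¹ * ∫ ξ, f ξ ∂(volume : Measure E3).toSphere‖ₑ ^ 2 ≤
      ∫⁻ ξ, ‖f ξ‖ₑ ^ 2 ∂(volume : Measure E3).toSphere := by
  have hpi : 0 < 4 * Real.pi := by positivity
  have h := enorm_integral_sq_le (volume : Measure E3).toSphere hf.aestronglyMeasurable
  rw [toSphere_univ] at h
  have h1 : ‖(4 * Real.pi)⁻¹‖ₑ = (ENNReal.ofReal (4 * Real.pi))⁻¹ := by
    rw [Real.enorm_eq_ofReal (by positivity), ENNReal.ofReal_inv_of_pos hpi]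
  have h2 : ENNReal.ofReal (4 * Real.pi) ≠ 0 := by simpa using hpi
  rw [enorm_mul, mul_pow, h1]
  set a := ENNReal.ofReal (4 * Real.pi)
  have h3 : a * a⁻¹ = 1 := ENNReal.mul_inv_cancel h2 ENNReal.ofReal_ne_top
  calc a * (a⁻¹ ^ 2 * ‖∫ ξ, f ξ ∂(volume : Measure E3).toSphere‖ₑ ^ 2)
      ≤ a * (a⁻¹ ^ 2 * (a * ∫⁻ ξ, ‖f ξ‖ₑ ^ 2 ∂(volume : Measure E3).toSphere)) := by gcongr
    _ = (a * a⁻¹) * (a * a⁻¹) * ∫⁻ ξ, ‖f ξ‖ₑ ^ 2 ∂(volume : Measure E3).toSphere := by ring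
    _ = _ := by rw [h3]; simp

lemma integrable_sphere {f : Metric.sphere (0 : E3) 1 → ℝ} (hf : Continuous f) :
    Integrable f (volume : Measure E3).toSphere :=
  hf.integrable_of_hasCompactSupport (HasCompactSupport.of_compactSpace f)

lemma enorm_sub_sphereAverage_sq_le {φ : E3 → ℝ} (hφ : Continuous φ) (a : ℝ) (c : E3) (ρ : ℝ) :
    ENNReal.ofReal (4 * Real.pi) * ‖a - sphereAverage φ c ρ‖ₑ ^ 2 ≤
      ∫⁻ ξ : Metric.sphere (0 : E3) 1, ‖a - φ (c + ρ • (ξ : E3))‖ₑ ^ 2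
        ∂(volume : Measure E3).toSphere := by
  have hc : Continuous fun ξ : Metric.sphere (0 : E3) 1 => φ (c + ρ • (ξ : E3)) := by fun_prop
  have h := enorm_average_sq_le (f := fun ξ => a - φ (c + ρ • (ξ : E3))) (by fun_prop)
  rw [integral_sub (integrable_const a) (integrable_sphere hc), integral_const, mul_sub,
    measureReal_def, toSphere_univ, ENNReal.toReal_ofReal (by positivity), smul_eq_mul,
    inv_mul_cancel_left₀ (by positivity)] at h
  exact h

/-- Jensen's inequality on the unit sphere reduces this to the ray estimate, whose integral over
directions is the energy of the shell. -/
lemma sphereAverage_sub_sq_le {φ : E3 → ℝ} (hφ : ContDiff ℝ 1 φ) (c : E3) {r R : ℝ}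
    (hr : 0 < r) (hR : r ≤ R) :
    ENNReal.ofReal (4 * Real.pi) * ‖sphereAverage φ c R - sphereAverage φ c r‖ₑ ^ 2 ≤
      ENNReal.ofReal r⁻¹ *
        ∫⁻ x in {x | r < dist x c ∧ dist x c < R}, ‖gradient φ x‖ₑ ^ 2 := by
  have hφc := hφ.continuous
  have hF : Measurable fun x => ‖gradient φ x‖ₑ ^ 2 :=
    hφ.continuous_gradient.measurable.enorm.pow_const 2
  have hc : ∀ ρ : ℝ, Continuous fun ξ : Metric.sphere (0 : E3) 1 => φ (c + ρ • (ξ : E3)) :=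
    fun ρ => by fun_prop
  have h := enorm_average_sq_le ((hc R).sub (hc r))
  simp only [Pi.sub_apply] at h
  rw [integral_sub (integrable_sphere (hc R)) (integrable_sphere (hc r)), mul_sub] at h
  refine h.trans ?_
  have hpol := setLIntegral_polar hF c measurableSet_Ioo
    (Set.Ioo_subset_Ioi_self.trans (Set.Ioi_subset_Ioi hr.le) : Set.Ioo r R ⊆ Set.Ioi 0)
  simp only [Set.mem_Ioo] at hpol
  rw [hpol, ← lintegral_const_mul' _ _ ENNReal.ofReal_ne_top]
  exact lintegral_mono fun ξ => hφ.enorm_sub_sq_le_ray c ξ hr hR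

/-- The trace inequality on a sphere, for compactly supported functions. -/
lemma lintegral_sphere_sq_le {φ : E3 → ℝ} (hφ : ContDiff ℝ 1 φ) (hs : HasCompactSupport φ)
    (c : E3) {ρ : ℝ} (hρ : 0 < ρ) :
    ∫⁻ ξ : Metric.sphere (0 : E3) 1, ‖φ (c + ρ • (ξ : E3))‖ₑ ^ 2
        ∂(volume : Measure E3).toSphere ≤
      ENNReal.ofReal ρ⁻¹ * ∫⁻ x, ‖gradient φ x‖ₑ ^ 2 := by
  have hF : Measurable fun x => ‖gradient φ x‖ₑ ^ 2 :=
    hφ.continuous_gradient.measurable.enorm.pow_const 2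
  -- The sphere of radius b lies outside the support, so the ray increment from ρ to b is the value
  -- at radius ρ up to sign.
  obtain ⟨b, hb, hsub⟩ := hs.isCompact.isBounded.subset_ball_lt ρ c
  rw [lintegral_polar hF c, ← lintegral_const_mul' _ _ ENNReal.ofReal_ne_top]
  refine lintegral_mono fun ξ => ?_
  have h0 : φ (c + b • (ξ : E3)) = 0 := by
    refine image_eq_zero_of_notMem_tsupport fun h => ?_
    have := hsub h
    rw [Metric.mem_ball, dist_eq_norm, add_sub_cancel_left, norm_smul,
      mem_sphere_zero_iff_norm.1 ξ.2, Real.norm_of_nonneg (hρ.trans hb).le] at this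
    linarith
  have h := hφ.enorm_sub_sq_le_ray c ξ hρ hb.le
  rw [h0, zero_sub, enorm_neg] at h
  refine h.trans ?_
  gcongr
  exact Set.Ioo_subset_Ioi_self.trans (Set.Ioi_subset_Ioi hρ.le)

/-! ### Poincaré inequalities on balls. -/

lemma volume_ball_eq (c : E3) {L : ℝ} (hL : 0 ≤ L) :
    volume (Metric.ball c L) = ENNReal.ofReal (4 * Real.pi / 3 * L ^ 3) := by
  rw [EuclideanSpace.volume_ball_fin_three, ← ENNReal.ofReal_pow hL,
    ← ENNReal.ofReal_mul (by positivity)]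
  congr 1
  ring

lemma setLIntegral_Ioo_ofReal_pow {L : ℝ} (hL : 0 ≤ L) (n : ℕ) :
    ∫⁻ s in Set.Ioo 0 L, ENNReal.ofReal (s ^ n) = ENNReal.ofReal (L ^ (n + 1) / (n + 1)) := by
  rw [Measure.restrict_congr_set Ioo_ae_eq_Ioc, ← ofReal_integral_eq_lintegral_ofReal,
    ← intervalIntegral.integral_of_le hL]
  · simp
  · exact (intervalIntegral.intervalIntegrable_pow n).1
  · filter_upwards [ae_restrict_mem measurableSet_Ioc] with y hy
    exact pow_nonneg hy.1.le _

/-- In each direction ξ, pass from φ(x) to φ(c + Lξ) through φ(c + sξ) and average over s ∈ (0, L)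
with weight s². Integrated over ξ, the first difference becomes an integral over the ball; the
second is a ray increment. -/
lemma volume_ball_mul_enorm_sub_sphereAverage_sq_le {φ : E3 → ℝ} (hφ : ContDiff ℝ 1 φ) (c x : E3)
    {L : ℝ} (hL : 0 < L) :
    volume (Metric.ball c L) * ‖φ x - sphereAverage φ c L‖ₑ ^ 2 ≤
      2 * (∫⁻ y in Metric.ball c L, ‖φ x - φ y‖ₑ ^ 2) +
        ENNReal.ofReal (L ^ 2) * ∫⁻ y in Metric.ball c L, ‖gradient φ y‖ₑ ^ 2 := by
  have hφc := hφ.continuous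
  have hF : Measurable fun x => ‖gradient φ x‖ₑ ^ 2 :=
    hφ.continuous_gradient.measurable.enorm.pow_const 2
  have hF1 : Measurable fun y => ‖φ x - φ y‖ₑ ^ 2 :=
    ((continuous_const.sub hφc).measurable.enorm).pow_const 2
  have hvol : volume (Metric.ball c L)
      = ENNReal.ofReal (L ^ 3 / 3) * ENNReal.ofReal (4 * Real.pi) := by
    rw [volume_ball_eq c hL.le, ← ENNReal.ofReal_mul (by positivity)]
    congr 1
    ring
  set I : Metric.sphere (0 : E3) 1 → ℝ≥0∞ := fun ξ => ∫⁻ s in Set.Ioo 0 L,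
    ENNReal.ofReal (s ^ 2) * ‖gradient φ (c + s • (ξ : E3))‖ₑ ^ 2 with hI
  set J : Metric.sphere (0 : E3) 1 → ℝ≥0∞ := fun ξ => ∫⁻ s in Set.Ioo 0 L,
    ENNReal.ofReal (s ^ 2) * ‖φ x - φ (c + s • (ξ : E3))‖ₑ ^ 2 with hJ
  have hJm : Measurable J := by
    have : Measurable fun p : Metric.sphere (0 : E3) 1 × ℝ =>
        ENNReal.ofReal (p.2 ^ 2) * ‖φ x - φ (c + p.2 • (p.1 : E3))‖ₑ ^ 2 :=
      (by fun_prop : Measurable _).mul (hF1.comp (by fun_prop))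
    exact this.lintegral_prod_right'
  have hray : ∀ ξ : Metric.sphere (0 : E3) 1, ENNReal.ofReal (L ^ 3 / 3) *
      ‖φ x - φ (c + L • (ξ : E3))‖ₑ ^ 2 ≤ 2 * J ξ + ENNReal.ofReal (L ^ 2) * I ξ := by
    intro ξ
    have hmeas : Measurable fun s : ℝ => 2 * (ENNReal.ofReal (s ^ 2) *
        ‖φ x - φ (c + s • (ξ : E3))‖ₑ ^ 2) :=
      ((by fun_prop : Measurable _).mul (hF1.comp (by fun_prop))).const_mul _
    have h3 : ENNReal.ofReal (L ^ 3 / 3) = ∫⁻ s in Set.Ioo 0 L, ENNReal.ofReal (s ^ 2) := by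
      rw [setLIntegral_Ioo_ofReal_pow hL.le]
      norm_num
    have h2 : ENNReal.ofReal (L ^ 2) = 2 * ∫⁻ s in Set.Ioo 0 L, ENNReal.ofReal s := by
      have := setLIntegral_Ioo_ofReal_pow hL.le 1
      simp only [pow_one] at this
      rw [this, ← ENNReal.ofReal_ofNat, ← ENNReal.ofReal_mul (by positivity)]
      congr 1
      norm_num
      ring
    rw [h3, ← lintegral_mul_const'' _ (by fun_prop)]
    calc ∫⁻ s in Set.Ioo 0 L, ENNReal.ofReal (s ^ 2) * ‖φ x - φ (c + L • (ξ : E3))‖ₑ ^ 2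
        ≤ ∫⁻ s in Set.Ioo 0 L, (2 * (ENNReal.ofReal (s ^ 2) *
            ‖φ x - φ (c + s • (ξ : E3))‖ₑ ^ 2) + 2 * (ENNReal.ofReal s * I ξ)) := by
          refine setLIntegral_mono' measurableSet_Ioo fun s hs => ?_
          -- Enlarging (s, L) to (0, L) makes the energy factor independent of s; the weight s² then
          -- absorbs the singular factor s⁻¹.
          have h4 : ‖φ (c + s • (ξ : E3)) - φ (c + L • (ξ : E3))‖ₑ ^ 2
              ≤ ENNReal.ofReal s⁻¹ * I ξ := by
            rw [← enorm_neg, neg_sub]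
            refine (hφ.enorm_sub_sq_le_ray c ξ hs.1 hs.2.le).trans ?_
            gcongr
            exact lintegral_mono_set (Set.Ioo_subset_Ioo_left hs.1.le)
          calc _ ≤ ENNReal.ofReal (s ^ 2) * (2 * ‖φ x - φ (c + s • (ξ : E3))‖ₑ ^ 2 +
                2 * (ENNReal.ofReal s⁻¹ * I ξ)) := by
                gcongr
                refine le_trans ?_ ((enorm_add_sq_le _ _).trans (add_le_add_right
                  (mul_le_mul_right h4 2) _))
                rw [sub_add_sub_cancel]
            _ = 2 * (ENNReal.ofReal (s ^ 2) * ‖φ x - φ (c + s • (ξ : E3))‖ₑ ^ 2) +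
                2 * ((ENNReal.ofReal (s ^ 2) * ENNReal.ofReal s⁻¹) * I ξ) := by ring
            _ = _ := by
                rw [← ENNReal.ofReal_mul (by positivity), pow_two,
                  mul_inv_cancel_right₀ hs.1.ne']
      _ = _ := by
          rw [lintegral_add_left hmeas, lintegral_const_mul' _ _ (by simp),
            lintegral_const_mul' _ _ (by simp), lintegral_mul_const'' _ (by fun_prop), h2, mul_assoc]
  rw [hvol, mul_assoc]
  calc ENNReal.ofReal (L ^ 3 / 3) * (ENNReal.ofReal (4 * Real.pi) *
        ‖φ x - sphereAverage φ c L‖ₑ ^ 2)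
      ≤ ENNReal.ofReal (L ^ 3 / 3) * ∫⁻ ξ : Metric.sphere (0 : E3) 1,
          ‖φ x - φ (c + L • (ξ : E3))‖ₑ ^ 2 ∂(volume : Measure E3).toSphere := by
        gcongr
        exact enorm_sub_sphereAverage_sq_le hφc _ _ _
    _ = ∫⁻ ξ : Metric.sphere (0 : E3) 1, ENNReal.ofReal (L ^ 3 / 3) *
          ‖φ x - φ (c + L • (ξ : E3))‖ₑ ^ 2 ∂(volume : Measure E3).toSphere :=
        (lintegral_const_mul' _ _ ENNReal.ofReal_ne_top).symm
    _ ≤ ∫⁻ ξ, (2 * J ξ + ENNReal.ofReal (L ^ 2) * I ξ) ∂(volume : Measure E3).toSphere :=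
        lintegral_mono hray
    _ = _ := by
        rw [lintegral_add_left (hJm.const_mul _), lintegral_const_mul' _ _ (by simp),
          lintegral_const_mul' _ _ ENNReal.ofReal_ne_top, setLIntegral_ball_polar hF,
          setLIntegral_ball_polar hF1]

/-- The Poincaré inequality on a ball, with the mean value over the bounding sphere. -/
lemma lintegral_ball_sub_sphereAverage_sq_le {φ : E3 → ℝ} (hφ : ContDiff ℝ 1 φ) (c : E3)
    {L : ℝ} (hL : 0 < L) :
    ∫⁻ x in Metric.ball c L, ‖φ x - sphereAverage φ c L‖ₑ ^ 2 ≤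
      ENNReal.ofReal (65 * L ^ 2) * ∫⁻ x in Metric.ball c L, ‖gradient φ x‖ₑ ^ 2 := by
  have hφc := hφ.continuous
  have hV0 : volume (Metric.ball c L) ≠ 0 := (Metric.measure_ball_pos _ _ hL).ne'
  have hV : volume (Metric.ball c L) ≠ ⊤ := measure_ball_lt_top.ne
  rw [← ENNReal.mul_le_mul_iff_right hV0 hV, ← lintegral_const_mul' _ _ hV]
  refine (lintegral_mono fun x =>
    volume_ball_mul_enorm_sub_sphereAverage_sq_le hφ c x hL).trans ?_
  rw [lintegral_add_right _ measurable_const, lintegral_const_mul' _ _ (by simp), setLIntegral_const]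
  grw [hφ.lintegral_lintegral_sub_sq_le c hL]
  refine le_of_eq ?_
  -- 65 = 2 · 32 + 1: the double integral counted twice, plus the ray term.
  have : ENNReal.ofReal (65 * L ^ 2)
      = 2 * ENNReal.ofReal (32 * L ^ 2) + ENNReal.ofReal (L ^ 2) := by
    rw [← ENNReal.ofReal_ofNat, ← ENNReal.ofReal_mul (by positivity),
      ← ENNReal.ofReal_add (by positivity) (by positivity)]
    congr 1
    ring
  rw [this]
  ring

/-- The Poincaré inequality on a ball, for functions that vanish on a part of it. -/
lemma volume_mul_lintegral_ball_sq_le {φ : E3 → ℝ} (hφ : ContDiff ℝ 1 φ) (c : E3)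
    {L : ℝ} (hL : 0 < L) {N : Set E3} (hN : MeasurableSet N) (hNL : N ⊆ Metric.ball c L)
    (h0 : ∀ y ∈ N, φ y = 0) :
    volume N * ∫⁻ x in Metric.ball c L, ‖φ x‖ₑ ^ 2 ≤ volume (Metric.ball c L) *
      (ENNReal.ofReal (32 * L ^ 2) * ∫⁻ x in Metric.ball c L, ‖gradient φ x‖ₑ ^ 2) := by
  refine le_trans ?_ (hφ.lintegral_lintegral_sub_sq_le c hL)
  rw [← lintegral_const_mul' _ _ (measure_ne_top_of_subset hNL measure_ball_lt_top.ne)]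
  refine lintegral_mono fun x => ?_
  calc volume N * ‖φ x‖ₑ ^ 2 = ∫⁻ y in N, ‖φ x - φ y‖ₑ ^ 2 := by
        rw [setLIntegral_congr_fun hN (g := fun _ => ‖φ x‖ₑ ^ 2) fun y hy => by simp [h0 y hy],
          setLIntegral_const, mul_comm]
    _ ≤ _ := lintegral_mono_set hNL

/-- The Poincaré inequality on a ball, with the mean value over a smaller concentric sphere. -/
lemma lintegral_ball_sub_sphereAverage_sq_le_of_le {φ : E3 → ℝ} (hφ : ContDiff ℝ 1 φ) (c : E3)
    {R L : ℝ} (hR : 0 < R) (hRL : R ≤ L) :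
    ∫⁻ x in Metric.ball c L, ‖φ x - sphereAverage φ c R‖ₑ ^ 2 ≤
      ENNReal.ofReal (131 * (L ^ 3 / R)) * ∫⁻ x in Metric.ball c L, ‖gradient φ x‖ₑ ^ 2 := by
  have hL : 0 < L := hR.trans_le hRL
  have hφc := hφ.continuous
  set P := ∫⁻ x in Metric.ball c L, ‖gradient φ x‖ₑ ^ 2 with hP
  have h1 : volume (Metric.ball c L) * ‖sphereAverage φ c L - sphereAverage φ c R‖ₑ ^ 2 ≤
      ENNReal.ofReal (L ^ 3 / (3 * R)) * P := by
    rw [volume_ball_eq c hL.le, show 4 * Real.pi / 3 * L ^ 3 = L ^ 3 / 3 * (4 * Real.pi) by ring,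
      ENNReal.ofReal_mul (by positivity), mul_assoc]
    refine (mul_le_mul_right (sphereAverage_sub_sq_le hφ c hR hRL) _).trans ?_
    rw [← mul_assoc, ← ENNReal.ofReal_mul (by positivity)]
    refine mul_le_mul' (le_of_eq ?_) (lintegral_mono_set fun x hx => hx.2)
    congr 1
    field_simp
  calc ∫⁻ x in Metric.ball c L, ‖φ x - sphereAverage φ c R‖ₑ ^ 2
      ≤ ∫⁻ x in Metric.ball c L, (2 * ‖φ x - sphereAverage φ c L‖ₑ ^ 2 +
          2 * ‖sphereAverage φ c L - sphereAverage φ c R‖ₑ ^ 2) := by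
        refine lintegral_mono fun x => ?_
        refine le_trans (le_of_eq ?_) (enorm_add_sq_le _ _)
        rw [sub_add_sub_cancel]
    _ ≤ 2 * (ENNReal.ofReal (65 * L ^ 2) * P) + 2 * (ENNReal.ofReal (L ^ 3 / (3 * R)) * P) := by
        rw [lintegral_add_right _ measurable_const, lintegral_const_mul' _ _ (by simp),
          setLIntegral_const, mul_assoc, mul_comm (‖_‖ₑ ^ 2)]
        gcongr
        exact lintegral_ball_sub_sphereAverage_sq_le hφ c hL
    _ = ENNReal.ofReal (2 * (65 * L ^ 2) + 2 * (L ^ 3 / (3 * R))) * P := by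
        rw [ENNReal.ofReal_add (by positivity) (by positivity), ENNReal.ofReal_mul zero_le_two,
          ENNReal.ofReal_mul zero_le_two, ENNReal.ofReal_ofNat]
        ring
    _ ≤ _ := by
        gcongr
        -- As R ≤ L, the total 130 L² + (2/3) L³/R is at most 131 L³/R.
        have h2 : L ^ 2 ≤ L ^ 3 / R := by
          rw [le_div_iff₀ hR]
          nlinarith [sq_nonneg L]
        have h3 : L ^ 3 / (3 * R) = L ^ 3 / R / 3 := by field_simp
        rw [h3]
        linarith [(by positivity : 0 ≤ L ^ 3 / R)]

/-! ### Passage to the limit in L². -/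

section NormSq

variable {F : Type*} [NormedAddCommGroup F] {μ : Measure E3}

lemma eLpNorm_two_sq (μ : Measure E3) (f : E3 → F) : eLpNorm f 2 μ ^ 2 = normSq μ f := by
  have h := eLpNorm_nnreal_pow_eq_lintegral (f := f) (μ := μ) (p := 2) two_ne_zero
  simpa [normSq] using h

lemma tendsto_eLpNorm_sub_restrict {f : E3 → F} {f' : ℕ → E3 → F} (s : Set E3)
    (h : Tendsto (fun n => eLpNorm (f - f' n) 2 μ) atTop (𝓝 0)) :
    Tendsto (fun n => eLpNorm (f - f' n) 2 (μ.restrict s)) atTop (𝓝 0) :=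
  tendsto_of_tendsto_of_tendsto_of_le_of_le tendsto_const_nhds h (fun _ => zero_le)
    fun _ => eLpNorm_restrict_le _ _ _ _

lemma tendsto_normSq {f : E3 → F} {f' : ℕ → E3 → F} (hf : AEStronglyMeasurable f μ)
    (hf' : ∀ n, AEStronglyMeasurable (f' n) μ)
    (h : Tendsto (fun n => eLpNorm (f - f' n) 2 μ) atTop (𝓝 0)) :
    Tendsto (fun n => normSq μ (f' n)) atTop (𝓝 (normSq μ f)) := by
  simp only [← eLpNorm_two_sq]
  refine ((ENNReal.continuous_pow 2).tendsto _).comp ?_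
  have hlow : Tendsto (fun n => eLpNorm f 2 μ - eLpNorm (f - f' n) 2 μ) atTop
      (𝓝 (eLpNorm f 2 μ)) := by
    simpa using ENNReal.Tendsto.sub (tendsto_const_nhds (x := eLpNorm f 2 μ)) h (Or.inr (by simp))
  have hup : Tendsto (fun n => eLpNorm f 2 μ + eLpNorm (f - f' n) 2 μ) atTop
      (𝓝 (eLpNorm f 2 μ)) := by
    simpa using (tendsto_const_nhds (x := eLpNorm f 2 μ)).add h
  refine tendsto_of_tendsto_of_tendsto_of_le_of_le hlow hup (fun n => ?_) fun n => ?_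
  · refine tsub_le_iff_right.2 ?_
    have := eLpNorm_add_le (hf' n) (hf.sub (hf' n)) (p := 2) (by norm_num)
    rwa [add_sub_cancel] at this
  · have := eLpNorm_add_le hf ((hf' n).sub hf) (p := 2) (by norm_num)
    rw [add_sub_cancel] at this
    rwa [eLpNorm_sub_comm] at this

lemma tendsto_of_enorm_sub_sq {a : ℕ → F} {b : F}
    (h : Tendsto (fun n => ‖a n - b‖ₑ ^ 2) atTop (𝓝 0)) : Tendsto a atTop (𝓝 b) := by
  rw [tendsto_iff_edist_tendsto_0]
  have h2 := ((ENNReal.continuous_rpow_const (y := (1 / 2 : ℝ))).tendsto _).comp h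
  simp only [one_div, ENNReal.zero_rpow_of_pos (by norm_num : (0 : ℝ) < 2⁻¹)] at h2
  refine h2.congr fun n => ?_
  rw [Function.comp_apply, ← ENNReal.rpow_natCast, ← ENNReal.rpow_mul, edist_eq_enorm_sub]
  norm_num

end NormSq

/-- Smooth compactly supported functions `φ n` converge to `u`, and their gradients to `g`, in
`L²`. -/
structure SmoothApprox (u : E3 → ℝ) (g : E3 → E3) (φ : ℕ → E3 → ℝ) : Prop where
  contDiff : ∀ n, ContDiff ℝ 1 (φ n)
  hasCompactSupport : ∀ n, HasCompactSupport (φ n)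
  memLp : MemLp u 2 volume
  memLp_grad : MemLp g 2 volume
  tendsto : Tendsto (fun n => eLpNorm (u - φ n) 2 volume) atTop (𝓝 0)
  tendsto_grad : Tendsto (fun n => eLpNorm (g - gradient (φ n)) 2 volume) atTop (𝓝 0)

namespace SmoothApprox

variable {u : E3 → ℝ} {g : E3 → E3} {φ ψ : ℕ → E3 → ℝ}

lemma tendsto_normSq_grad (h : SmoothApprox u g φ) (s : Set E3) :
    Tendsto (fun n => normSq (volume.restrict s) (gradient (φ n))) atTop
      (𝓝 (normSq (volume.restrict s) g)) :=
  tendsto_normSq h.memLp_grad.1.restrict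
    (fun n => (h.contDiff n).continuous_gradient.aestronglyMeasurable)
    (tendsto_eLpNorm_sub_restrict s h.tendsto_grad)

/-- The ball has finite measure, so convergence of the constants m is convergence in L² and the
smooth inequality passes to the limit. -/
lemma normSq_ball_sub_le (h : SmoothApprox u g φ) {c : E3} {R L m : ℝ} (hR : 0 < R)
    (hRL : R ≤ L) (hm : Tendsto (fun n => sphereAverage (φ n) c R) atTop (𝓝 m)) :
    normSq (volume.restrict (Metric.ball c L)) (fun x => u x - m) ≤
      ENNReal.ofReal (131 * (L ^ 3 / R)) * normSq (volume.restrict (Metric.ball c L)) g := by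
  set μ := (volume : Measure E3).restrict (Metric.ball c L) with hμ
  have : IsFiniteMeasure μ := ⟨by
    simpa [μ] using measure_ball_lt_top (μ := (volume : Measure E3)) (x := c) (r := L)⟩
  have hu : AEStronglyMeasurable u μ := h.memLp.1.restrict
  have hφ : ∀ n, AEStronglyMeasurable (φ n) μ :=
    fun n => (h.contDiff n).continuous.aestronglyMeasurable
  have h1 : Tendsto (fun n => eLpNorm (fun _ : E3 => sphereAverage (φ n) c R - m) 2 μ) atTop
      (𝓝 0) := by
    have h2 : Tendsto (fun n => ‖sphereAverage (φ n) c R - m‖ₑ) atTop (𝓝 0) := by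
      have := tendsto_iff_edist_tendsto_0.1 hm
      simpa only [edist_eq_enorm_sub] using this
    have h3 := ENNReal.Tendsto.mul_const (b := μ Set.univ ^ (1 / (2 : ℝ≥0∞).toReal)) h2
      (Or.inr (ENNReal.rpow_ne_top_of_nonneg (by positivity) (measure_ne_top _ _)))
    rw [zero_mul] at h3
    refine h3.congr fun n => ?_
    rw [eLpNorm_const' _ two_ne_zero (by simp)]
  have h4 : Tendsto (fun n => eLpNorm ((fun x => u x - m) -
      fun x => φ n x - sphereAverage (φ n) c R) 2 μ) atTop (𝓝 0) := by
    have h5 := (tendsto_eLpNorm_sub_restrict (Metric.ball c L) h.tendsto).add h1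
    rw [add_zero] at h5
    refine tendsto_of_tendsto_of_tendsto_of_le_of_le tendsto_const_nhds h5 (fun _ => zero_le)
      fun n => ?_
    refine le_trans (le_of_eq ?_) (eLpNorm_add_le (hu.sub (hφ n)) aestronglyMeasurable_const
      (by norm_num))
    congr 1
    ext x
    simp only [Pi.sub_apply, Pi.add_apply]
    ring
  refine le_of_tendsto_of_tendsto' (tendsto_normSq (hu.sub aestronglyMeasurable_const)
    (fun n => (hφ n).sub aestronglyMeasurable_const) h4)
    (ENNReal.Tendsto.const_mul (h.tendsto_normSq_grad _) (Or.inr ENNReal.ofReal_ne_top)) fun n => ?_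
  exact lintegral_ball_sub_sphereAverage_sq_le_of_le (h.contDiff n) c hR hRL

lemma enorm_sub_sq_le (h : SmoothApprox u g φ) {c : E3} {r R m M : ℝ} (hr : 0 < r)
    (hR : r ≤ R) (hm : Tendsto (fun n => sphereAverage (φ n) c r) atTop (𝓝 m))
    (hM : Tendsto (fun n => sphereAverage (φ n) c R) atTop (𝓝 M)) :
    ENNReal.ofReal (4 * Real.pi) * ‖M - m‖ₑ ^ 2 ≤ ENNReal.ofReal r⁻¹ *
      normSq (volume.restrict {x | r < dist x c ∧ dist x c < R}) g := by
  have h1 : Tendsto (fun n => ‖sphereAverage (φ n) c R - sphereAverage (φ n) c r‖ₑ ^ 2) atTop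
      (𝓝 (‖M - m‖ₑ ^ 2)) :=
    ((ENNReal.continuous_pow 2).tendsto _).comp ((continuous_enorm.tendsto _).comp (hM.sub hm))
  exact le_of_tendsto_of_tendsto'
    (ENNReal.Tendsto.const_mul h1 (Or.inr ENNReal.ofReal_ne_top))
    (ENNReal.Tendsto.const_mul (h.tendsto_normSq_grad _) (Or.inr ENNReal.ofReal_ne_top))
    fun n => sphereAverage_sub_sq_le (h.contDiff n) c hr hR

lemma volume_mul_normSq_ball_le (h : SmoothApprox u g φ) (c : E3) {L : ℝ} (hL : 0 < L)
    {N : Set E3} (hN : MeasurableSet N) (hNL : N ⊆ Metric.ball c L)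
    (h0 : ∀ n, ∀ y ∈ N, φ n y = 0) :
    volume N * normSq (volume.restrict (Metric.ball c L)) u ≤ volume (Metric.ball c L) *
      (ENNReal.ofReal (32 * L ^ 2) * normSq (volume.restrict (Metric.ball c L)) g) :=
  le_of_tendsto_of_tendsto'
    (ENNReal.Tendsto.const_mul (tendsto_normSq h.memLp.1.restrict
      (fun n => (h.contDiff n).continuous.aestronglyMeasurable)
      (tendsto_eLpNorm_sub_restrict _ h.tendsto))
      (Or.inr (measure_ne_top_of_subset hNL measure_ball_lt_top.ne)))
    (ENNReal.Tendsto.const_mul (ENNReal.Tendsto.const_mul (h.tendsto_normSq_grad _)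
      (Or.inr ENNReal.ofReal_ne_top)) (Or.inr measure_ball_lt_top.ne))
    fun n => volume_mul_lintegral_ball_sq_le (h.contDiff n) c hL hN hNL (h0 n)

lemma tendsto_normSq_grad_sub (h : SmoothApprox u g φ) (h' : SmoothApprox u g ψ) :
    Tendsto (fun n => normSq volume (gradient (φ n - ψ n))) atTop (𝓝 0) := by
  have h1 := h.tendsto_grad.add h'.tendsto_grad
  rw [add_zero] at h1
  have h2 : Tendsto (fun n => eLpNorm (gradient (φ n - ψ n)) 2 volume) atTop (𝓝 0) := by
    refine tendsto_of_tendsto_of_tendsto_of_le_of_le tendsto_const_nhds h1 (fun _ => zero_le)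
      fun n => ?_
    rw [gradient_sub ((h.contDiff n).differentiable one_ne_zero)
      ((h'.contDiff n).differentiable one_ne_zero), eLpNorm_sub_comm g (gradient (φ n)),
      ← sub_add_sub_cancel _ g]
    exact eLpNorm_add_le
      ((h.contDiff n).continuous_gradient.aestronglyMeasurable.sub h.memLp_grad.1)
      (h.memLp_grad.1.sub (h'.contDiff n).continuous_gradient.aestronglyMeasurable) (by norm_num)
  have h3 := ((ENNReal.continuous_pow 2).tendsto _).comp h2
  simpa only [Function.comp_def, eLpNorm_two_sq, zero_pow two_ne_zero] using h3

end SmoothApprox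

/-! ### Traces on spheres. -/

section Surface

lemma measurable_sphereMap (c : E3) (ρ : ℝ) :
    Measurable fun ξ : Metric.sphere (0 : E3) 1 => c + ρ • (ξ : E3) := by fun_prop

lemma lintegral_surfaceMeasure {f : E3 → ℝ≥0∞} (hf : Measurable f) (c : E3) (ρ : ℝ) :
    ∫⁻ x, f x ∂(surfaceMeasure c ρ) = ENNReal.ofReal (ρ ^ 2) *
      ∫⁻ ξ : Metric.sphere (0 : E3) 1, f (c + ρ • (ξ : E3)) ∂(volume : Measure E3).toSphere := by
  rw [surfaceMeasure, lintegral_smul_measure, lintegral_map hf (measurable_sphereMap c ρ),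
    smul_eq_mul]

instance isFiniteMeasure_surfaceMeasure (c : E3) (ρ : ℝ) :
    IsFiniteMeasure (surfaceMeasure c ρ) := by
  refine ⟨?_⟩
  rw [← lintegral_one, lintegral_surfaceMeasure measurable_const]
  exact ENNReal.mul_lt_top ENNReal.ofReal_lt_top (by rw [lintegral_one]; exact measure_lt_top _ _)

lemma integral_surfaceMeasure {φ : E3 → ℝ} (hφ : Continuous φ) (c : E3) {ρ : ℝ} (hρ : 0 < ρ) :
    (4 * Real.pi * ρ ^ 2)⁻¹ * ∫ x, φ x ∂(surfaceMeasure c ρ) = sphereAverage φ c ρ := by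
  rw [surfaceMeasure, integral_smul_measure, integral_map (measurable_sphereMap c ρ).aemeasurable
    hφ.aestronglyMeasurable, sphereAverage, ENNReal.toReal_ofReal (by positivity), smul_eq_mul]
  field_simp

lemma normSq_surfaceMeasure_le {φ : E3 → ℝ} (hφ : ContDiff ℝ 1 φ) (hs : HasCompactSupport φ)
    (c : E3) {ρ : ℝ} (hρ : 0 < ρ) :
    normSq (surfaceMeasure c ρ) φ ≤ ENNReal.ofReal ρ * normSq volume (gradient φ) := by
  rw [normSq, lintegral_surfaceMeasure (hφ.continuous.measurable.enorm.pow_const 2)]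
  grw [lintegral_sphere_sq_le hφ hs c hρ]
  rw [← mul_assoc, ← ENNReal.ofReal_mul (by positivity), pow_two, mul_inv_cancel_right₀ hρ.ne']
  rfl

lemma eLpNorm_surfaceMeasure_le {φ : E3 → ℝ} (hφ : ContDiff ℝ 1 φ) (hs : HasCompactSupport φ)
    (c : E3) {ρ : ℝ} (hρ : 0 < ρ) :
    eLpNorm φ 2 (surfaceMeasure c ρ) ≤
      ENNReal.ofReal (√ρ) * eLpNorm (gradient φ) 2 volume := by
  rw [← ENNReal.pow_le_pow_left_iff two_ne_zero, mul_pow, eLpNorm_two_sq, eLpNorm_two_sq,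
    ← ENNReal.ofReal_pow (by positivity), Real.sq_sqrt hρ.le]
  exact normSq_surfaceMeasure_le hφ hs c hρ

/-- The gradients form a Cauchy sequence in L², and by the trace inequality so do the restrictions
to the sphere; completeness gives the trace. -/
lemma SmoothApprox.exists_trace {u : E3 → ℝ} {g : E3 → E3} {φ : ℕ → E3 → ℝ}
    (h : SmoothApprox u g φ) (c : E3) {ρ : ℝ} (hρ : 0 < ρ) :
    ∃ w, MemLp w 2 (surfaceMeasure c ρ) ∧
      Tendsto (fun n => eLpNorm (w - φ n) 2 (surfaceMeasure c ρ)) atTop (𝓝 0) := by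
  have hLp : ∀ n, MemLp (φ n) 2 (surfaceMeasure c ρ) := fun n =>
    (h.contDiff n).continuous.memLp_of_hasCompactSupport (h.hasCompactSupport n)
  have hg : ∀ n, MemLp (gradient (φ n)) 2 (volume : Measure E3) := fun n =>
    (h.contDiff n).continuous_gradient.memLp_of_hasCompactSupport
      ((h.hasCompactSupport n).fderiv ℝ |>.comp_left (map_zero _))
  have hgc : Tendsto (fun n => (hg n).toLp) atTop (𝓝 h.memLp_grad.toLp) := by
    rw [tendsto_iff_edist_tendsto_0]
    simp only [Lp.edist_toLp_toLp]
    exact h.tendsto_grad.congr fun n => eLpNorm_sub_comm _ _ _ _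
  obtain ⟨b, hb, hb0⟩ := EMetric.cauchySeq_iff_le_tendsto_0.1 hgc.cauchySeq
  have hcau : CauchySeq fun n => (hLp n).toLp := by
    refine EMetric.cauchySeq_iff_le_tendsto_0.2 ⟨fun n => ENNReal.ofReal (√ρ) * b n, ?_, ?_⟩
    · intro n m N hn hm
      have h1 := hb n m N hn hm
      rw [Lp.edist_toLp_toLp] at h1 ⊢
      rw [← gradient_sub ((h.contDiff n).differentiable one_ne_zero)
        ((h.contDiff m).differentiable one_ne_zero)] at h1
      refine (eLpNorm_surfaceMeasure_le ((h.contDiff n).sub (h.contDiff m))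
        ((h.hasCompactSupport n).sub (h.hasCompactSupport m)) c hρ).trans ?_
      exact mul_le_mul_right h1 _
    · simpa using ENNReal.Tendsto.const_mul hb0 (Or.inr ENNReal.ofReal_ne_top)
  obtain ⟨w, hw⟩ := cauchySeq_tendsto_of_complete hcau
  refine ⟨w, Lp.memLp w, ?_⟩
  rw [Lp.tendsto_Lp_iff_tendsto_eLpNorm'] at hw
  refine hw.congr fun n => ?_
  rw [eLpNorm_sub_comm]
  exact eLpNorm_congr_ae (EventuallyEq.rfl.sub (hLp n).coeFn_toLp)

lemma tendsto_integral_of_eLpNorm_two {μ : Measure E3} [IsFiniteMeasure μ] {w : E3 → ℝ}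
    {φ : ℕ → E3 → ℝ} (hw : MemLp w 2 μ) (hφ : ∀ n, MemLp (φ n) 2 μ)
    (h : Tendsto (fun n => eLpNorm (w - φ n) 2 μ) atTop (𝓝 0)) :
    Tendsto (fun n => ∫ x, φ n x ∂μ) atTop (𝓝 (∫ x, w x ∂μ)) := by
  refine tendsto_of_enorm_sub_sq ?_
  have h1 := ENNReal.Tendsto.const_mul (((ENNReal.continuous_pow 2).tendsto _).comp h)
    (Or.inr (measure_ne_top μ Set.univ))
  simp only [Function.comp_def, eLpNorm_two_sq, zero_pow two_ne_zero, mul_zero] at h1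
  refine tendsto_of_tendsto_of_tendsto_of_le_of_le tendsto_const_nhds h1 (fun _ => zero_le)
    fun n => ?_
  rw [← enorm_neg, neg_sub, ← integral_sub (hw.integrable (by norm_num))
    ((hφ n).integrable (by norm_num))]
  exact enorm_integral_sq_le μ (hw.1.sub (hφ n).1)

/-- Sphere averages do not depend asymptotically on the approximating sequence, by the trace
inequality for φ n − ψ n. -/
lemma SmoothApprox.tendsto_sphereAverage_sub {u : E3 → ℝ} {g : E3 → E3} {φ ψ : ℕ → E3 → ℝ}
    (h : SmoothApprox u g φ) (h' : SmoothApprox u g ψ) (c : E3) {ρ : ℝ} (hρ : 0 < ρ) :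
    Tendsto (fun n => sphereAverage (φ n) c ρ - sphereAverage (ψ n) c ρ) atTop (𝓝 0) := by
  refine tendsto_of_enorm_sub_sq ?_
  have hpi0 : ENNReal.ofReal (4 * Real.pi) ≠ 0 := by simp [Real.pi_pos]
  have h1 := ENNReal.Tendsto.const_mul (h.tendsto_normSq_grad_sub h')
    (Or.inr (ENNReal.mul_ne_top (ENNReal.inv_ne_top.2 hpi0)
      (ENNReal.ofReal_ne_top (r := ρ⁻¹))))
  rw [mul_zero] at h1
  refine tendsto_of_tendsto_of_tendsto_of_le_of_le tendsto_const_nhds h1 (fun _ => zero_le)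
    fun n => ?_
  have hc : ∀ f : E3 → ℝ, Continuous f →
      Continuous fun ξ : Metric.sphere (0 : E3) 1 => f (c + ρ • (ξ : E3)) :=
    fun f hf => by fun_prop
  have h2 := enorm_average_sq_le (hc _ ((h.contDiff n).sub (h'.contDiff n)).continuous)
  have h3 := h2.trans (lintegral_sphere_sq_le ((h.contDiff n).sub (h'.contDiff n))
    ((h.hasCompactSupport n).sub (h'.hasCompactSupport n)) c hρ)
  rw [integral_sub (integrable_sphere (hc _ (h.contDiff n).continuous))
    (integrable_sphere (hc _ (h'.contDiff n).continuous)), mul_sub] at h3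
  rw [sub_zero, mul_assoc, ← ENNReal.div_eq_inv_mul, ENNReal.le_div_iff_mul_le (Or.inl hpi0)
    (Or.inl ENNReal.ofReal_ne_top), mul_comm]
  exact h3

end Surface

/-! ### Weak gradients and extension by zero. -/

section Extension

variable {Ω : Set E3}

/-- The fundamental lemma of the calculus of variations. It identifies the gradient hidden in
`TestApprox` with the given one. -/
lemma Suspension.HasWeakGradient.ae_eq (hΩ : IsOpen Ω) {u : E3 → ℝ} {G G' : E3 → E3}
    (h : HasWeakGradient Ω u G) (h' : HasWeakGradient Ω u G') :
    G =ᵐ[volume.restrict Ω] G' := by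
  have key : ∀ᵐ x ∂(volume : Measure E3), x ∈ Ω → (G - G') x = 0 := by
    refine hΩ.ae_eq_zero_of_integral_contDiff_smul_eq_zero (h.2.1.sub h'.2.1) ?_
    intro φ hφ hc hs
    have hint : ∀ H : E3 → E3, LocallyIntegrableOn H Ω →
        Integrable (fun x => φ x • H x) (volume.restrict Ω) := by
      intro H hH
      have h1 := (hH.integrableOn_compact_subset hs hc).continuousOn_smul
        hφ.continuous.continuousOn hc
      refine Integrable.restrict ((integrableOn_iff_integrable_of_support_subset ?_).1 h1)
      exact fun x hx => subset_tsupport φ fun h0 => hx (by simp [h0])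
    rw [← setIntegral_eq_integral_of_forall_compl_eq_zero (s := Ω)]
    · simp only [Pi.sub_apply, smul_sub]
      rw [integral_sub (hint G h.2.1) (hint G' h'.2.1), sub_eq_zero, ← neg_inj,
        ← h.2.2 φ ⟨hφ, hc, hs⟩, ← h'.2.2 φ ⟨hφ, hc, hs⟩]
    · intro x hx
      rw [image_eq_zero_of_notMem_tsupport fun h0 => hx (hs h0), zero_smul]
  refine (ae_restrict_iff' hΩ.measurableSet).2 (key.mono fun x hx hxΩ => ?_)
  exact sub_eq_zero.1 (hx hxΩ)

lemma Suspension.IsTest.eq_zero {φ : E3 → ℝ} (h : IsTest Ω φ) {x : E3} (hx : x ∉ Ω) : φ x = 0 :=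
  image_eq_zero_of_notMem_tsupport fun h0 => hx (h.2.2 h0)

lemma Suspension.IsTest.gradient_eq_zero {φ : E3 → ℝ} (h : IsTest Ω φ) {x : E3} (hx : x ∉ Ω) :
    gradient φ x = 0 := by
  have : fderiv ℝ φ x = 0 := by
    by_contra h0
    exact hx (h.2.2 (support_fderiv_subset ℝ h0))
  simp [gradient, this]

lemma tendsto_eLpNorm_indicator_sub {F : Type*} [NormedAddCommGroup F] (hΩ : MeasurableSet Ω)
    {f : E3 → F} {f' : ℕ → E3 → F} (h0 : ∀ n, ∀ x ∉ Ω, f' n x = 0)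
    (h : Tendsto (fun n => eLpNorm (f - f' n) 2 (volume.restrict Ω)) atTop (𝓝 0)) :
    Tendsto (fun n => eLpNorm (Ω.indicator f - f' n) 2 volume) atTop (𝓝 0) := by
  refine h.congr fun n => ?_
  rw [← eLpNorm_indicator_eq_eLpNorm_restrict hΩ]
  congr 1
  ext1 x
  by_cases hx : x ∈ Ω
  · simp [hx]
  · simp [hx, h0 n x hx]

/-- Extension by zero. -/
lemma Suspension.TestApprox.smoothApprox (hΩ : IsOpen Ω) {θ : E3 → ℝ} {gradθ : E3 → E3} {φ : ℕ → E3 → ℝ}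
    (h : TestApprox Ω θ φ) (hg : HasWeakGradient Ω θ gradθ) :
    SmoothApprox (Ω.indicator θ) (Ω.indicator gradθ) φ := by
  obtain ⟨hφ, hθ, G, hG, hGL, hconv, hconvG⟩ := h
  have hae := hG.ae_eq hΩ hg
  refine ⟨fun n => (hφ n).1.of_le (by simp), fun n => (hφ n).2.1,
    (memLp_indicator_iff_restrict hΩ.measurableSet).2 hθ,
    (memLp_indicator_iff_restrict hΩ.measurableSet).2 (hGL.ae_eq hae),
    tendsto_eLpNorm_indicator_sub hΩ.measurableSet (fun n x hx => (hφ n).eq_zero hx) hconv,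
    tendsto_eLpNorm_indicator_sub hΩ.measurableSet (fun n x hx => (hφ n).gradient_eq_zero hx)
      (hconvG.congr fun n => eLpNorm_congr_ae (hae.sub EventuallyEq.rfl))⟩

lemma Suspension.TestApprox.tendsto_sphereAverage (hΩ : IsOpen Ω) {θ : E3 → ℝ} {gradθ : E3 → E3}
    {φ : ℕ → E3 → ℝ} (h : TestApprox Ω θ φ) (hg : HasWeakGradient Ω θ gradθ) (c : E3) {ρ : ℝ}
    (hρ : 0 < ρ) :
    Tendsto (fun n => sphereAverage (φ n) c ρ) atTop (𝓝 (sphereMean Ω θ c ρ)) := by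
  have hs := h.smoothApprox hΩ hg
  have hex : ∃ w, IsSphereTrace Ω θ c ρ w := by
    obtain ⟨w, hw, hwφ⟩ := hs.exists_trace c hρ
    exact ⟨w, hw, φ, h, hwφ⟩
  -- The chosen trace comes with its own sequence ψ, which must be compared with φ.
  obtain ⟨hw, ψ, hψ, hwψ⟩ : IsSphereTrace Ω θ c ρ (sphereTrace Ω θ c ρ) := by
    rw [sphereTrace, dif_pos hex]
    exact hex.choose_spec
  have hs' := hψ.smoothApprox hΩ hg
  have h1 := (tendsto_integral_of_eLpNorm_two hw (fun n =>
    (hs'.contDiff n).continuous.memLp_of_hasCompactSupport (hs'.hasCompactSupport n))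
    hwψ).const_mul (4 * Real.pi * ρ ^ 2)⁻¹
  have h2 := (hs.tendsto_sphereAverage_sub hs' c hρ).add h1
  rw [zero_add] at h2
  refine h2.congr fun n => ?_
  rw [integral_surfaceMeasure (hs'.contDiff n).continuous c hρ, sub_add_cancel]

end Extension

/-! ### Geometry of the lattice. -/

section Cells

variable {ε : ℝ}

lemma center_apply (ε : ℝ) (k : Fin 3 → ℤ) (i : Fin 3) : center ε k i = ε * k i := rfl

lemma isOpen_cell (ε : ℝ) (k : Fin 3 → ℤ) : IsOpen (cell ε k) := by
  have : cell ε k = ⋂ i, (fun x : E3 => x i - center ε k i) ⁻¹' Set.Ioo (-(ε / 2)) (ε / 2) := by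
    ext x
    simp [cell]
  rw [this]
  exact isOpen_iInter_of_finite fun i => isOpen_Ioo.preimage (by fun_prop)

lemma convex_cell (ε : ℝ) (k : Fin 3 → ℤ) : Convex ℝ (cell ε k) := by
  intro x hx y hy a b ha hb hab i
  have := convex_Ioo (-(ε / 2)) (ε / 2) (hx i) (hy i) ha hb hab
  convert this using 1
  simp only [PiLp.add_apply, PiLp.smul_apply, smul_eq_mul]
  linear_combination center ε k i * hab

lemma volume_cell (hε : 0 < ε) (k : Fin 3 → ℤ) : volume (cell ε k) = ENNReal.ofReal (ε ^ 3) := by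
  have h1 : cell ε k = (WithLp.ofLp : E3 → Fin 3 → ℝ) ⁻¹' Set.pi Set.univ
      fun i => Set.Ioo (center ε k i - ε / 2) (center ε k i + ε / 2) := by
    ext x
    simp only [cell, Set.mem_ofPred_eq, Set.mem_preimage, Set.mem_pi, Set.mem_univ, true_implies,
      Set.mem_Ioo]
    refine forall_congr' fun i => and_congr ?_ ?_ <;> constructor <;> intro h <;> linarith
  rw [h1, (PiLp.volume_preserving_ofLp (Fin 3)).measure_preimage
    (MeasurableSet.univ_pi fun i => measurableSet_Ioo).nullMeasurableSet, Real.volume_pi_Ioo]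
  simp only [add_sub_sub_cancel, add_halves, Finset.prod_const, Finset.card_univ, Fintype.card_fin]
  rw [ENNReal.ofReal_pow hε.le]

lemma disjoint_cell (hε : 0 < ε) {k l : Fin 3 → ℤ} (hkl : k ≠ l) :
    Disjoint (cell ε k) (cell ε l) := by
  rw [Set.disjoint_left]
  intro x hx hy
  refine hkl (funext fun i => ?_)
  have h1 := hx i
  have h2 := hy i
  simp only [center_apply, Set.mem_Ioo] at h1 h2
  have h3 : ε * ((k i : ℝ) - l i) < ε * 1 := by linarith
  have h4 : ε * ((l i : ℝ) - k i) < ε * 1 := by linarith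
  rw [mul_lt_mul_iff_right₀ hε] at h3 h4
  have h5 : k i - l i < 1 := by exact_mod_cast h3
  have h6 : l i - k i < 1 := by exact_mod_cast h4
  omega

lemma ae_mem_iUnion_cell (hε : 0 < ε) : ∀ᵐ x : E3, ∃ k, x ∈ cell ε k := by
  have h1 : ∀ i : Fin 3, ∀ n : ℤ, ∀ᵐ x : E3, x i ≠ ε * (n + 1 / 2) := by
    intro i n
    have h := Measure.ae_eval_ne (μ := fun _ : Fin 3 => (volume : Measure ℝ)) i (ε * (n + 1 / 2))
    exact (PiLp.volume_preserving_ofLp (Fin 3)).quasiMeasurePreserving.ae h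
  have h2 : ∀ᵐ x : E3, ∀ i : Fin 3, ∀ n : ℤ, x i ≠ ε * (n + 1 / 2) :=
    ae_all_iff.2 fun i => ae_all_iff.2 fun n => h1 i n
  filter_upwards [h2] with x hx
  refine ⟨fun i => ⌊x i / ε + 1 / 2⌋, fun i => ?_⟩
  set n := ⌊x i / ε + 1 / 2⌋ with hn
  have h3 := Int.floor_le (x i / ε + 1 / 2)
  have h4 := Int.lt_floor_add_one (x i / ε + 1 / 2)
  rw [← hn] at h3 h4
  have h5 : x i / ε * ε = x i := div_mul_cancel₀ _ hε.ne'
  have h6 : ε * ((n : ℝ) - 1 / 2) ≤ x i := by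
    rw [← h5, mul_comm]
    gcongr
    linarith
  have h7 : x i < ε * ((n : ℝ) + 1 / 2) := by
    nth_rewrite 1 [← h5]
    rw [mul_comm]
    gcongr
    linarith
  -- The floor gives only a weak inequality at the lower face ε(n − 1/2); off the null set of faces
  -- it is strict.
  have h8 := hx i (n - 1)
  push_cast at h8
  have h9 : ε * ((n : ℝ) - 1 / 2) ≠ x i := fun h => h8 (by rw [← h]; ring)
  have h10 := lt_of_le_of_ne h6 h9
  simp only [center_apply, Set.mem_Ioo]
  constructor <;> linarith

lemma ball_subset_cell {r : ℝ} (hr : r ≤ ε / 2) (k : Fin 3 → ℤ) :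
    Metric.ball (center ε k) r ⊆ cell ε k := by
  intro x hx i
  rw [Metric.mem_ball, dist_eq_norm] at hx
  have h := (PiLp.norm_apply_le (x - center ε k) i).trans_lt hx
  rw [Real.norm_eq_abs, PiLp.sub_apply, abs_lt] at h
  exact ⟨by linarith [h.1], by linarith [h.2]⟩

lemma cell_subset_ball (hε : 0 < ε) (k : Fin 3 → ℤ) :
    cell ε k ⊆ Metric.ball (center ε k) ε := by
  intro x hx
  rw [Metric.mem_ball, EuclideanSpace.dist_eq, Real.sqrt_lt' hε]
  have h : ∀ i, dist (x i) (center ε k i) ^ 2 ≤ (ε / 2) ^ 2 := by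
    intro i
    have := hx i
    rw [Real.dist_eq, sq_abs]
    exact sq_le_sq' this.1.le this.2.le
  calc ∑ i, dist (x i) (center ε k i) ^ 2 ≤ ∑ _i : Fin 3, (ε / 2) ^ 2 :=
        Finset.sum_le_sum fun i _ => h i
    _ < ε ^ 2 := by
        simp only [Finset.sum_const, Finset.card_univ, Fintype.card_fin, nsmul_eq_mul]
        push_cast
        nlinarith

/-- The balls of radius `2ε` around the points `εk` overlap boundedly. -/
lemma tsum_lintegral_ball_le (hε : 0 < ε) {f : E3 → ℝ≥0∞} (hf : AEMeasurable f) :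
    ∑' k, ∫⁻ x in Metric.ball (center ε k) (2 * ε), f x ≤ 125 * ∫⁻ x, f x := by
  simp only [← lintegral_indicator measurableSet_ball]
  rw [← lintegral_tsum fun k => hf.indicator measurableSet_ball,
    ← lintegral_const_mul' _ _ (by simp)]
  refine lintegral_mono fun x => ?_
  -- If x lies in the ball around εk, each coordinate of k differs from x i / ε by less than 2. Five
  -- integers per coordinate suffice, hence 5³ = 125.
  set S : Finset (Fin 3 → ℤ) :=
    Fintype.piFinset fun i => Finset.Icc (⌊x i / ε⌋ - 2) (⌊x i / ε⌋ + 2) with hS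
  have hcard : S.card = 125 := by
    rw [hS, Fintype.card_piFinset]
    simp only [Int.card_Icc]
    have : ∀ i : Fin 3, (⌊x i / ε⌋ + 2 + 1 - (⌊x i / ε⌋ - 2)).toNat = 5 := fun i => by omega
    simp [this]
  rw [tsum_eq_sum (s := S)]
  · calc ∑ k ∈ S, (Metric.ball (center ε k) (2 * ε)).indicator f x ≤ S.card • f x :=
          Finset.sum_le_card_nsmul _ _ _ fun k _ => Set.indicator_le_self _ _ _
      _ = 125 * f x := by rw [hcard, nsmul_eq_mul]; norm_num
  · intro k hk
    refine Set.indicator_of_notMem (fun hx => hk ?_) _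
    rw [hS, Fintype.mem_piFinset]
    intro i
    rw [Metric.mem_ball, dist_eq_norm] at hx
    have h := (PiLp.norm_apply_le (x - center ε k) i).trans_lt hx
    rw [Real.norm_eq_abs, PiLp.sub_apply, center_apply, abs_lt] at h
    have h5 : x i / ε * ε = x i := div_mul_cancel₀ _ hε.ne'
    have h1 : ((k i : ℝ) - 2) * ε < x i / ε * ε := by rw [h5]; linarith [h.1]
    have h2 : x i / ε * ε < ((k i : ℝ) + 2) * ε := by rw [h5]; linarith [h.2]
    rw [mul_lt_mul_iff_left₀ hε] at h1 h2
    have h3 := Int.floor_le (x i / ε)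
    have h4 := Int.lt_floor_add_one (x i / ε)
    have h6 : k i - 2 < ⌊x i / ε⌋ + 1 := by exact_mod_cast h1.trans h4
    have h7 : ⌊x i / ε⌋ < k i + 2 := by
      rw [← Int.cast_lt (R := ℝ)]
      push_cast
      exact h3.trans_lt h2
    rw [Finset.mem_Icc]
    omega

lemma lintegral_biUnion_inter_cell_le (hε : 0 < ε) (S : Set (Fin 3 → ℤ)) (A : Set E3)
    {f h : E3 → ℝ≥0∞} (hh : AEMeasurable h) {K : ℝ≥0∞}
    (hK : ∀ k ∈ S, ∫⁻ x in A ∩ cell ε k, f x ≤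
      K * ∫⁻ x in Metric.ball (center ε k) (2 * ε), h x) :
    ∫⁻ x in ⋃ k ∈ S, A ∩ cell ε k, f x ≤ K * (125 * ∫⁻ x, h x) := by
  rw [Set.biUnion_eq_iUnion]
  calc ∫⁻ x in ⋃ k : S, A ∩ cell ε k, f x ≤ ∑' k : S, ∫⁻ x in A ∩ cell ε k, f x :=
        lintegral_iUnion_le _ _
    _ ≤ ∑' k : S, K * ∫⁻ x in Metric.ball (center ε (k : Fin 3 → ℤ)) (2 * ε), h x :=
        ENNReal.tsum_le_tsum fun k => hK k k.2
    _ ≤ ∑' k, K * ∫⁻ x in Metric.ball (center ε k) (2 * ε), h x :=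
        ENNReal.tsum_comp_le_tsum_of_injective Subtype.val_injective _
    _ ≤ _ := by
        rw [ENNReal.tsum_mul_left]
        gcongr
        exact tsum_lintegral_ball_le hε hh

end Cells

/-! ### Functions constant on cells. -/

section CellMean

variable {Ω : Set E3} {u : E3 → ℝ} {ε ρ : ℝ}

lemma cellMean_eq (hε : 0 < ε) {k : Fin 3 → ℤ} (hk : k ∈ cellIndices Ω ε) {x : E3}
    (hx : x ∈ cell ε k) : cellMean Ω u ε ρ x = sphereMean Ω u (center ε k) ρ := by
  rw [cellMean, tsum_eq_single ⟨k, hk⟩, Set.indicator_of_mem hx]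
  intro l hl
  refine Set.indicator_of_notMem (fun h => ?_) _
  exact Set.disjoint_left.1 (disjoint_cell hε fun h' => hl (Subtype.ext h')) h hx

lemma cellMean_eq_zero {x : E3} (hx : x ∉ cells Ω ε) : cellMean Ω u ε ρ x = 0 := by
  rw [cellMean]
  have : ∀ k : cellIndices Ω ε, (cell ε (k : Fin 3 → ℤ)).indicator
      (fun _ => sphereMean Ω u (center ε k) ρ) x = 0 := fun k =>
    Set.indicator_of_notMem (fun h => hx (Set.mem_biUnion k.2 h)) _
  simp [this]

lemma notMem_cells (hε : 0 < ε) {k : Fin 3 → ℤ} (hk : k ∉ cellIndices Ω ε) {x : E3}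
    (hx : x ∈ cell ε k) : x ∉ cells Ω ε := by
  intro h
  obtain ⟨l, hl, hxl⟩ := Set.mem_iUnion₂.1 h
  exact Set.disjoint_left.1 (disjoint_cell hε fun h' : k = l => hk (h' ▸ hl)) hx hxl

lemma cells_subset : cells Ω ε ⊆ Ω := Set.iUnion₂_subset fun _ hk => hk

lemma measurableSet_cells : MeasurableSet (cells Ω ε) :=
  (isOpen_biUnion fun k _ => isOpen_cell ε k).measurableSet

lemma pairwiseDisjoint_of_subset_cell (hε : 0 < ε) (S : Set (Fin 3 → ℤ))
    {B : (Fin 3 → ℤ) → Set E3} (hB : ∀ k, B k ⊆ cell ε k) : S.PairwiseDisjoint B :=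
  fun k _ l _ hkl => (disjoint_cell hε hkl).mono (hB k) (hB l)

lemma normSq_biUnion (hε : 0 < ε) {B : (Fin 3 → ℤ) → Set E3} (hB : ∀ k, B k ⊆ cell ε k)
    (hBm : ∀ k, MeasurableSet (B k)) (S : Set (Fin 3 → ℤ)) {F : Type*} [NormedAddCommGroup F]
    (f : E3 → F) :
    normSq (volume.restrict (⋃ k ∈ S, B k)) f =
      ∑' k : S, normSq (volume.restrict (B (k : Fin 3 → ℤ))) f :=
  lintegral_biUnion (Set.to_countable S) (fun k _ => hBm k)
    (pairwiseDisjoint_of_subset_cell hε S hB) _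

lemma normSq_restrict_const {B : Set E3} (hB : MeasurableSet B) {f : E3 → ℝ} {a : ℝ}
    (h : ∀ x ∈ B, f x = a) : normSq (volume.restrict B) f = volume B * ‖a‖ₑ ^ 2 := by
  rw [normSq, setLIntegral_congr_fun hB (g := fun _ => ‖a‖ₑ ^ 2) fun x hx => by simp only [h x hx],
    setLIntegral_const, mul_comm]

lemma normSq_cellwise (hε : 0 < ε) (hΩ : MeasurableSet Ω) {f : E3 → ℝ} {a : (Fin 3 → ℤ) → ℝ}
    (h0 : ∀ x ∉ cells Ω ε, f x = 0)
    (ha : ∀ k ∈ cellIndices Ω ε, ∀ x ∈ cell ε k, f x = a k) :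
    normSq (volume.restrict Ω) f =
      ∑' k : cellIndices Ω ε, ENNReal.ofReal (ε ^ 3) * ‖a k‖ₑ ^ 2 := by
  have h1 : normSq (volume.restrict Ω) f = normSq (volume.restrict (cells Ω ε)) f := by
    simp only [normSq]
    rw [← lintegral_indicator hΩ, ← lintegral_indicator measurableSet_cells]
    congr 1
    ext x
    by_cases hx : x ∈ cells Ω ε
    · simp [hx, cells_subset hx]
    · simp [hx, h0 x hx]
  rw [h1, cells, normSq_biUnion hε (fun _ => subset_rfl) fun k => (isOpen_cell ε k).measurableSet]
  refine tsum_congr fun k => ?_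
  rw [normSq_restrict_const (isOpen_cell ε k).measurableSet (ha k k.2), volume_cell hε]

/-- The density of the suspension measure is the ratio of the cell volume ε³ to the ball volume, and
the function is constant on each cell. -/
lemma normSq_cellMean_eq (hΩ : MeasurableSet Ω) {r : ℝ} (hr : 0 < r) (hrε : r ≤ ε / 2) :
    normSq (volume.restrict Ω) (cellMean Ω u ε ρ)
      = normSq (suspensionMeasure Ω ε r) (cellMean Ω u ε ρ) := by
  have hε : 0 < ε := by linarith
  have h2 : normSq (suspensionMeasure Ω ε r) (cellMean Ω u ε ρ) =
      ENNReal.ofReal (3 / (4 * Real.pi) * (ε / r) ^ 3) *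
        normSq (volume.restrict (suspensions Ω ε r)) (cellMean Ω u ε ρ) := by
    rw [normSq, suspensionMeasure, lintegral_smul_measure, smul_eq_mul]
    rfl
  rw [h2, normSq_cellwise hε hΩ (fun x hx => cellMean_eq_zero hx)
    (fun k hk x hx => cellMean_eq hε hk hx), suspensions,
    normSq_biUnion hε (fun k => ball_subset_cell hrε k) (fun k => measurableSet_ball),
    ← ENNReal.tsum_mul_left]
  refine tsum_congr fun k => ?_
  rw [normSq_restrict_const measurableSet_ball
    (fun x hx => cellMean_eq hε k.2 (ball_subset_cell hrε k hx)), volume_ball_eq _ hr.le,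
    ← mul_assoc, ← ENNReal.ofReal_mul (by positivity)]
  congr 2
  field_simp

end CellMean

/-! ### Exterior density and boundary cells. -/

section Density

variable {Ω : Set E3}

/-- For bounded sets, exterior measure density at small scales implies it at all scales. -/
lemma Suspension.ExteriorDensity.exists_forall (hb : Bornology.IsBounded Ω)
    (h : ExteriorDensity Ω) :
    ∃ c > (0 : ℝ), ∀ z ∈ frontier Ω, ∀ ρ : ℝ, 0 < ρ →
      ENNReal.ofReal (c * ρ ^ 3) ≤ volume (Metric.ball z ρ \ Ω) := by
  obtain ⟨c, hc, ρ₀, hρ₀, h⟩ := h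
  obtain ⟨M, hM, hsub⟩ := hb.subset_ball_lt ρ₀ 0
  have hM0 : 0 < M := hρ₀.trans hM
  have hq : 0 < ρ₀ / (2 * M) := by positivity
  -- For ρ ≤ 2M shrink the radius by the factor ρ₀/(2M). For ρ > 2M remove from the ball all of B(0,
  -- M) ⊇ Ω, which has at most 1/8 of its volume.
  refine ⟨min 1 (c * (ρ₀ / (2 * M)) ^ 3), by positivity, fun z hz ρ hρ => ?_⟩
  rcases le_or_gt ρ (2 * M) with hρM | hρM
  · set ρ' := ρ₀ / (2 * M) * ρ with hρ'
    have h1 : ρ' ≤ ρ₀ := by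
      rw [hρ', div_mul_eq_mul_div]
      exact div_le_of_le_mul₀ (by positivity) hρ₀.le (by gcongr)
    have h2 : ρ' ≤ ρ := by
      refine mul_le_of_le_one_left hρ.le ?_
      rw [div_le_one (by positivity)]
      linarith
    calc ENNReal.ofReal (min 1 (c * (ρ₀ / (2 * M)) ^ 3) * ρ ^ 3)
        ≤ ENNReal.ofReal (c * ρ' ^ 3) := by
          refine ENNReal.ofReal_le_ofReal ?_
          rw [hρ', mul_pow, ← mul_assoc]
          gcongr
          exact min_le_right _ _
      _ ≤ volume (Metric.ball z ρ' \ Ω) := h z hz ρ' (by positivity) h1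
      _ ≤ _ := measure_mono (Set.sdiff_subset_sdiff_left (Metric.ball_subset_ball h2))
  · calc ENNReal.ofReal (min 1 (c * (ρ₀ / (2 * M)) ^ 3) * ρ ^ 3)
        ≤ ENNReal.ofReal (4 * Real.pi / 3 * ρ ^ 3 - 4 * Real.pi / 3 * M ^ 3) := by
          refine ENNReal.ofReal_le_ofReal ?_
          have h3 : M ^ 3 ≤ (ρ / 2) ^ 3 := by
            gcongr
            linarith
          have h4 := Real.pi_gt_three
          have h5 : 0 < ρ ^ 3 := by positivity
          have h6 : min 1 (c * (ρ₀ / (2 * M)) ^ 3) * ρ ^ 3 ≤ 1 * ρ ^ 3 := by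
            gcongr
            exact min_le_left _ _
          nlinarith
      _ = volume (Metric.ball z ρ) - volume (Metric.ball (0 : E3) M) := by
          rw [volume_ball_eq _ hρ.le, volume_ball_eq _ hM0.le, ENNReal.ofReal_sub _ (by positivity)]
      _ ≤ volume (Metric.ball z ρ \ Metric.ball (0 : E3) M) := le_measure_sdiff
      _ ≤ _ := measure_mono (Set.sdiff_subset_sdiff_right hsub)

/-- Otherwise Ω and the complement of its closure would disconnect the cell, which is convex. -/
lemma exists_mem_frontier_cell (hΩ : IsOpen Ω) {ε : ℝ} {k : Fin 3 → ℤ}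
    (hk : k ∉ cellIndices Ω ε) (hne : (Ω ∩ cell ε k).Nonempty) :
    ∃ z ∈ frontier Ω, z ∈ cell ε k := by
  obtain ⟨x, hxΩ, hx⟩ := hne
  obtain ⟨y, hy, hyΩ⟩ := Set.not_subset.1 hk
  by_contra! hcon
  have h1 : ∀ z ∈ cell ε k, z ∈ closure Ω → z ∈ Ω := by
    intro z hz hzc
    by_contra hzΩ
    exact hcon z (by rw [hΩ.frontier_eq]; exact ⟨hzc, hzΩ⟩) hz
  obtain ⟨z, -, hz1, hz2⟩ := (convex_cell ε k).isPreconnected Ω (closure Ω)ᶜ hΩ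
    isClosed_closure.isOpen_compl
    (fun z hz => or_iff_not_imp_right.2 fun h => h1 z hz (not_not.1 h)) ⟨x, hx, hxΩ⟩
    ⟨y, hy, fun h => hyΩ (h1 y hy h)⟩
  exact hz2 (subset_closure hz1)

end Density

/-! ### The estimates on cells and their sums. -/

section Estimates

variable {Ω : Set E3} {ε r R : ℝ} {θ : E3 → ℝ} {gradθ : E3 → E3} {φ : ℕ → E3 → ℝ}

lemma normSq_indicator {F : Type*} [NormedAddCommGroup F] (hΩ : MeasurableSet Ω) (f : E3 → F) :
    normSq volume (Ω.indicator f) = normSq (volume.restrict Ω) f := by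
  simp only [normSq]
  rw [← lintegral_indicator hΩ]
  congr 1
  ext x
  by_cases hx : x ∈ Ω <;> simp [hx]

lemma normSq_restrict_congr {F : Type*} [NormedAddCommGroup F] {s : Set E3} (hs : MeasurableSet s)
    {f f' : E3 → F} (h : ∀ x ∈ s, f x = f' x) :
    normSq (volume.restrict s) f = normSq (volume.restrict s) f' :=
  setLIntegral_congr_fun hs fun x hx => by simp only [h x hx]

/-- Poincaré on the ball of radius 2ε, with 1048 = 131 · 2³. The radius is chosen so that the same
ball serves the boundary cells. -/
lemma normSq_cell_sub_cellMean_le (hΩ : IsOpen Ω) (hR : 0 < R) (hRε : R ≤ ε / 2)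
    (hφ : TestApprox Ω θ φ) (hg : HasWeakGradient Ω θ gradθ) {k : Fin 3 → ℤ}
    (hk : k ∈ cellIndices Ω ε) :
    normSq (volume.restrict (Ω ∩ cell ε k)) (θ - cellMean Ω θ ε R) ≤
      ENNReal.ofReal (1048 * (ε ^ 3 / R)) *
        normSq (volume.restrict (Metric.ball (center ε k) (2 * ε))) (Ω.indicator gradθ) := by
  have hε : 0 < ε := by linarith
  have h := (hφ.smoothApprox hΩ hg).normSq_ball_sub_le hR (by linarith : R ≤ 2 * ε)
    (hφ.tendsto_sphereAverage hΩ hg (center ε k) hR)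
  calc normSq (volume.restrict (Ω ∩ cell ε k)) (θ - cellMean Ω θ ε R)
      = normSq (volume.restrict (Ω ∩ cell ε k))
          (fun x => Ω.indicator θ x - sphereMean Ω θ (center ε k) R) := by
        refine normSq_restrict_congr (hΩ.inter (isOpen_cell ε k)).measurableSet fun x hx => ?_
        rw [Pi.sub_apply, cellMean_eq hε hk hx.2, Set.indicator_of_mem hx.1]
    _ ≤ _ := lintegral_mono_set (Set.inter_subset_right.trans ((cell_subset_ball hε k).trans
        (Metric.ball_subset_ball (by linarith))))
    _ ≤ _ := h
    _ = _ := by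
        congr 2
        ring

lemma normSq_boundary_cell_le (hΩ : IsOpen Ω) (hR : 0 < R) (hRε : R ≤ ε / 2)
    (hφ : TestApprox Ω θ φ) (hg : HasWeakGradient Ω θ gradθ) {c : ℝ} (hc : 0 < c)
    (hdens : ∀ z ∈ frontier Ω, ∀ ρ : ℝ, 0 < ρ →
      ENNReal.ofReal (c * ρ ^ 3) ≤ volume (Metric.ball z ρ \ Ω)) {k : Fin 3 → ℤ}
    (hk : k ∉ cellIndices Ω ε) :
    normSq (volume.restrict (Ω ∩ cell ε k)) (θ - cellMean Ω θ ε R) ≤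
      ENNReal.ofReal (4352 / c * (ε ^ 3 / R)) *
        normSq (volume.restrict (Metric.ball (center ε k) (2 * ε))) (Ω.indicator gradθ) := by
  have hε : 0 < ε := by linarith
  rcases Set.eq_empty_or_nonempty (Ω ∩ cell ε k) with he | hne
  · simp [he, normSq]
  obtain ⟨z, hz, hzc⟩ := exists_mem_frontier_cell hΩ hk hne
  have hN : Metric.ball z ε \ Ω ⊆ Metric.ball (center ε k) (2 * ε) := by
    refine Set.sdiff_subset.trans (Metric.ball_subset_ball' ?_)
    linarith [Metric.mem_ball.1 (cell_subset_ball hε k hzc)]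
  have h := (hφ.smoothApprox hΩ hg).volume_mul_normSq_ball_le (center ε k)
    (by linarith : 0 < 2 * ε) (measurableSet_ball.diff hΩ.measurableSet) hN
    fun n y hy => (hφ.1 n).eq_zero hy.2
  set A := normSq (volume.restrict (Metric.ball (center ε k) (2 * ε))) (Ω.indicator θ)
  set B := normSq (volume.restrict (Metric.ball (center ε k) (2 * ε))) (Ω.indicator gradθ)
  have h1 : ENNReal.ofReal (c * ε ^ 3) * A ≤
      ENNReal.ofReal (c * ε ^ 3) * (ENNReal.ofReal (4352 / c * (ε ^ 3 / R)) * B) := by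
    calc ENNReal.ofReal (c * ε ^ 3) * A ≤ volume (Metric.ball z ε \ Ω) * A := by
          gcongr
          exact hdens z hz ε hε
      _ ≤ _ := h
      _ ≤ _ := by
          rw [volume_ball_eq _ (by linarith), ← mul_assoc, ← mul_assoc,
            ← ENNReal.ofReal_mul (by positivity), ← ENNReal.ofReal_mul (by positivity)]
          gcongr ENNReal.ofReal ?_ * _
          -- The natural bound is ε²; it is weakened to ε³/R to match the interior cells.
          -- Numerically 4096π/3 < 4352.
          have h2 : ε ^ 2 ≤ ε ^ 3 / R := by
            rw [le_div_iff₀ hR, pow_succ ε 2]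
            gcongr
            linarith
          have hpi := Real.pi_lt_d2
          calc 4 * Real.pi / 3 * (2 * ε) ^ 3 * (32 * (2 * ε) ^ 2)
              = (4096 * Real.pi / 3) * (ε ^ 3 * ε ^ 2) := by ring
            _ ≤ 4352 * (ε ^ 3 * (ε ^ 3 / R)) := by
              gcongr
              linarith
            _ = c * ε ^ 3 * (4352 / c * (ε ^ 3 / R)) := by field_simp
  have hcε : 0 < c * ε ^ 3 := by positivity
  rw [ENNReal.mul_le_mul_iff_right (by simpa using hcε) ENNReal.ofReal_ne_top] at h1
  refine le_trans ?_ h1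
  calc normSq (volume.restrict (Ω ∩ cell ε k)) (θ - cellMean Ω θ ε R)
      = normSq (volume.restrict (Ω ∩ cell ε k)) (Ω.indicator θ) := by
        refine normSq_restrict_congr (hΩ.inter (isOpen_cell ε k)).measurableSet fun x hx => ?_
        rw [Pi.sub_apply, cellMean_eq_zero (notMem_cells hε hk hx.2), Set.indicator_of_mem hx.1,
          sub_zero]
    _ ≤ _ := lintegral_mono_set (Set.inter_subset_right.trans ((cell_subset_ball hε k).trans
        (Metric.ball_subset_ball (by linarith))))

lemma normSq_biUnion_sub_cellMean_le (hΩ : IsOpen Ω) (hε : 0 < ε) (hR : 0 < R)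
    (hφ : TestApprox Ω θ φ) (hg : HasWeakGradient Ω θ gradθ) (S : Set (Fin 3 → ℤ)) {K C : ℝ}
    (hKC : 125 * K ≤ C)
    (hS : ∀ k ∈ S, normSq (volume.restrict (Ω ∩ cell ε k)) (θ - cellMean Ω θ ε R) ≤
      ENNReal.ofReal (K * (ε ^ 3 / R)) *
        normSq (volume.restrict (Metric.ball (center ε k) (2 * ε))) (Ω.indicator gradθ)) :
    normSq (volume.restrict (⋃ k ∈ S, Ω ∩ cell ε k)) (θ - cellMean Ω θ ε R) ≤
      ENNReal.ofReal (C * (ε ^ 3 / R)) * normSq (volume.restrict Ω) gradθ := by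
  have hm : AEMeasurable fun x => ‖Ω.indicator gradθ x‖ₑ ^ 2 :=
    (hφ.smoothApprox hΩ hg).memLp_grad.1.enorm.pow_const 2
  refine (lintegral_biUnion_inter_cell_le hε S Ω hm hS).trans ?_
  rw [← mul_assoc, ← normSq_indicator hΩ.measurableSet]
  refine mul_le_mul_left ?_ _
  rw [← ENNReal.ofReal_ofNat, ← ENNReal.ofReal_mul' (by positivity)]
  refine ENNReal.ofReal_le_ofReal ?_
  rw [mul_right_comm, mul_comm K]
  gcongr

lemma normSq_cells_sub_cellMean_le (hΩ : IsOpen Ω) (hR : 0 < R) (hRε : R ≤ ε / 2)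
    (hφ : TestApprox Ω θ φ) (hg : HasWeakGradient Ω θ gradθ) {C : ℝ} (hC : 131000 ≤ C) :
    normSq (volume.restrict (cells Ω ε)) (θ - cellMean Ω θ ε R) ≤
      ENNReal.ofReal (C * (ε ^ 3 / R)) * normSq (volume.restrict Ω) gradθ := by
  have h1 : cells Ω ε = ⋃ k ∈ cellIndices Ω ε, Ω ∩ cell ε k :=
    Set.iUnion₂_congr fun k hk => (Set.inter_eq_self_of_subset_right hk).symm
  rw [h1]
  exact normSq_biUnion_sub_cellMean_le hΩ (by linarith) hR hφ hg _ (K := 1048) (by linarith)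
    fun k hk => normSq_cell_sub_cellMean_le hΩ hR hRε hφ hg hk

lemma normSq_sub_cellMean_le (hΩ : IsOpen Ω) (hR : 0 < R) (hRε : R ≤ ε / 2)
    (hφ : TestApprox Ω θ φ) (hg : HasWeakGradient Ω θ gradθ) {c : ℝ} (hc : 0 < c)
    (hdens : ∀ z ∈ frontier Ω, ∀ ρ : ℝ, 0 < ρ →
      ENNReal.ofReal (c * ρ ^ 3) ≤ volume (Metric.ball z ρ \ Ω)) {C : ℝ}
    (hC : 125 * max 1048 (4352 / c) ≤ C) :
    normSq (volume.restrict Ω) (θ - cellMean Ω θ ε R) ≤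
      ENNReal.ofReal (C * (ε ^ 3 / R)) * normSq (volume.restrict Ω) gradθ := by
  have hε : 0 < ε := by linarith
  have h1 : Ω =ᵐ[volume] ⋃ k ∈ (Set.univ : Set (Fin 3 → ℤ)), Ω ∩ cell ε k := by
    filter_upwards [ae_mem_iUnion_cell hε] with x hx
    refine propext ⟨fun h => ?_, fun h => ?_⟩
    · obtain ⟨k, hk⟩ := hx
      exact Set.mem_biUnion (Set.mem_univ k) ⟨h, hk⟩
    · obtain ⟨k, -, hk⟩ := Set.mem_iUnion₂.1 h
      exact hk.1
  nth_rewrite 1 [Measure.restrict_congr_set h1]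
  refine normSq_biUnion_sub_cellMean_le hΩ hε hR hφ hg _ hC fun k _ => ?_
  by_cases hk : k ∈ cellIndices Ω ε
  · refine (normSq_cell_sub_cellMean_le hΩ hR hRε hφ hg hk).trans ?_
    gcongr
    exact le_max_left _ _
  · refine (normSq_boundary_cell_le hΩ hR hRε hφ hg hc hdens hk).trans ?_
    gcongr
    exact le_max_right _ _

/-- The ball Poincaré inequality with both radii equal to r. The balls are disjoint and lie in Ω, so
no overlap factor or extension enters. -/
lemma normSq_suspensions_sub_cellMean_le (hΩ : IsOpen Ω) (hr : 0 < r) (hrε : r ≤ ε / 2)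
    (hφ : TestApprox Ω θ φ) (hg : HasWeakGradient Ω θ gradθ) {C : ℝ} (hC : 131 ≤ C) :
    normSq (volume.restrict (suspensions Ω ε r)) (θ - cellMean Ω θ ε r) ≤
      ENNReal.ofReal (C * r ^ 2) * normSq (volume.restrict (suspensions Ω ε r)) gradθ := by
  have hε : 0 < ε := by linarith
  have hB := ball_subset_cell hrε
  rw [suspensions, normSq_biUnion hε hB fun k => measurableSet_ball,
    normSq_biUnion hε hB fun k => measurableSet_ball, ← ENNReal.tsum_mul_left]
  refine ENNReal.tsum_le_tsum fun k => ?_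
  have hkΩ : Metric.ball (center ε (k : Fin 3 → ℤ)) r ⊆ Ω := (hB k).trans k.2
  calc normSq (volume.restrict (Metric.ball (center ε (k : Fin 3 → ℤ)) r)) (θ - cellMean Ω θ ε r)
      = normSq (volume.restrict (Metric.ball (center ε (k : Fin 3 → ℤ)) r))
          (fun x => Ω.indicator θ x - sphereMean Ω θ (center ε k) r) := by
        refine normSq_restrict_congr measurableSet_ball fun x hx => ?_
        rw [Pi.sub_apply, cellMean_eq hε k.2 (hB k hx), Set.indicator_of_mem (hkΩ hx)]
    _ ≤ _ := (hφ.smoothApprox hΩ hg).normSq_ball_sub_le hr le_rfl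
        (hφ.tendsto_sphereAverage hΩ hg (center ε k) hr)
    _ = ENNReal.ofReal (131 * r ^ 2) *
          normSq (volume.restrict (Metric.ball (center ε (k : Fin 3 → ℤ)) r)) gradθ := by
        rw [normSq_restrict_congr measurableSet_ball
          fun x hx => Set.indicator_of_mem (hkΩ hx) gradθ]
        congr 3
        field_simp
    _ ≤ _ := by gcongr

lemma normSq_cellMean_sub_le (hΩ : IsOpen Ω) (hr : 0 < r) (hrR : r < R) (hRε : R ≤ ε / 2)
    (hφ : TestApprox Ω θ φ) (hg : HasWeakGradient Ω θ gradθ) {C : ℝ} (hC : 1 ≤ C) :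
    normSq (volume.restrict Ω) (cellMean Ω θ ε R - cellMean Ω θ ε r) ≤
      ENNReal.ofReal (C * (ε ^ 3 / r)) * normSq (volume.restrict (shells Ω ε r R)) gradθ := by
  have hε : 0 < ε := by linarith
  have hB : ∀ k, {x | r < dist x (center ε k) ∧ dist x (center ε k) < R} ⊆ cell ε k :=
    fun k x hx => ball_subset_cell hRε k hx.2
  have hBm : ∀ k : Fin 3 → ℤ,
      MeasurableSet {x | r < dist x (center ε k) ∧ dist x (center ε k) < R} := fun k =>
    (by fun_prop : Measurable fun x : E3 => dist x (center ε k)) measurableSet_Ioo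
  rw [shells, normSq_biUnion hε hB hBm, ← ENNReal.tsum_mul_left,
    normSq_cellwise hε hΩ.measurableSet
      (a := fun k => sphereMean Ω θ (center ε k) R - sphereMean Ω θ (center ε k) r)
      (fun x hx => by rw [Pi.sub_apply, cellMean_eq_zero hx, cellMean_eq_zero hx, sub_zero])
      fun k hk x hx => by rw [Pi.sub_apply, cellMean_eq hε hk hx, cellMean_eq hε hk hx]]
  refine ENNReal.tsum_le_tsum fun k => ?_
  have h := (hφ.smoothApprox hΩ hg).enorm_sub_sq_le hr hrR.le
    (hφ.tendsto_sphereAverage hΩ hg (center ε k) hr)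
    (hφ.tendsto_sphereAverage hΩ hg (center ε k) (hr.trans hrR))
  rw [normSq_restrict_congr (hBm k)
    fun x hx => Set.indicator_of_mem (k.2 (hB k hx)) gradθ] at h
  have hpi := Real.pi_gt_three
  calc ENNReal.ofReal (ε ^ 3) *
        ‖sphereMean Ω θ (center ε k) R - sphereMean Ω θ (center ε k) r‖ₑ ^ 2
      ≤ ENNReal.ofReal (ε ^ 3) * (ENNReal.ofReal (4 * Real.pi) *
        ‖sphereMean Ω θ (center ε k) R - sphereMean Ω θ (center ε k) r‖ₑ ^ 2) := by
        gcongr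
        refine le_mul_of_one_le_left zero_le ?_
        rw [ENNReal.one_le_ofReal]
        linarith
    _ ≤ _ := mul_le_mul_right h _
    _ ≤ _ := by
        rw [← mul_assoc, ← ENNReal.ofReal_mul (by positivity), ← div_eq_mul_inv]
        gcongr
        exact le_mul_of_one_le_left (by positivity) hC

end Estimates

/-! ### The theorem. -/

theorem lemma2p3 (Ω : Set E3) (hΩ : IsOpen Ω) (hb : Bornology.IsBounded Ω) :
    ∃ C : ℝ, 0 < C ∧
      ∀ ε r R : ℝ, 0 < r → r < R → R ≤ ε / 2 →
        ∀ (θ : E3 → ℝ) (gradθ : E3 → E3), MemH10 Ω θ → HasWeakGradient Ω θ gradθ →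
          -- the first estimate, on the cells contained in `Ω`
          normSq (volume.restrict (cells Ω ε)) (θ - cellMean Ω θ ε R)
              ≤ ENNReal.ofReal (C * (ε ^ 3 / R)) * normSq (volume.restrict Ω) gradθ ∧
          -- the first estimate on all of `Ω`
          (ExteriorDensity Ω →
            normSq (volume.restrict Ω) (θ - cellMean Ω θ ε R)
              ≤ ENNReal.ofReal (C * (ε ^ 3 / R)) * normSq (volume.restrict Ω) gradθ) ∧
          -- the second estimate
          normSq (volume.restrict (suspensions Ω ε r)) (θ - cellMean Ω θ ε r)
              ≤ ENNReal.ofReal (C * r ^ 2)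
                * normSq (volume.restrict (suspensions Ω ε r)) gradθ ∧
          -- the third estimate
          normSq (volume.restrict Ω) (cellMean Ω θ ε R - cellMean Ω θ ε r)
              ≤ ENNReal.ofReal (C * (ε ^ 3 / r))
                * normSq (volume.restrict (shells Ω ε r R)) gradθ ∧
          -- the equalities of norms
          normSq (volume.restrict Ω) (cellMean Ω θ ε R)
              = normSq (suspensionMeasure Ω ε r) (cellMean Ω θ ε R) ∧
          normSq (volume.restrict Ω) (cellMean Ω θ ε r)
              = normSq (suspensionMeasure Ω ε r) (cellMean Ω θ ε r) := by
  -- C must be fixed before it is known whether the density condition is used. If the condition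
  -- fails, c = 1 is a dummy value and the estimate on all of Ω is vacuous.
  obtain ⟨c, hc, hdens⟩ : ∃ c > (0 : ℝ), ExteriorDensity Ω → ∀ z ∈ frontier Ω, ∀ ρ : ℝ, 0 < ρ →
      ENNReal.ofReal (c * ρ ^ 3) ≤ volume (Metric.ball z ρ \ Ω) := by
    by_cases h : ExteriorDensity Ω
    · obtain ⟨c, hc, h'⟩ := h.exists_forall hb
      exact ⟨c, hc, fun _ => h'⟩
    · exact ⟨1, one_pos, fun h' => absurd h' h⟩
  have hC : (1048 : ℝ) ≤ max 1048 (4352 / c) := le_max_left _ _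
  refine ⟨125 * max 1048 (4352 / c), by positivity, ?_⟩
  rintro ε r R hr hrR hRε θ gradθ ⟨φ, hφ⟩ hg
  have hR : 0 < R := hr.trans hrR
  have hrε : r ≤ ε / 2 := hrR.le.trans hRε
  exact ⟨normSq_cells_sub_cellMean_le hΩ hR hRε hφ hg (by linarith),
    fun h => normSq_sub_cellMean_le hΩ hR hRε hφ hg hc (hdens h) le_rfl,
    normSq_suspensions_sub_cellMean_le hΩ hr hrε hφ hg (by linarith),
    normSq_cellMean_sub_le hΩ hr hrR hRε hφ hg (by linarith),
    normSq_cellMean_eq hΩ.measurableSet hr hrε,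
    normSq_cellMean_eq hΩ.measurableSet hr hrε⟩
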